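/- Let $(M,\omega,J,B=\omega(\cdot,J\cdot))$ be a compact connected Kähler manifold of complex dimension $n$, and let $G$ be a compact connected Lie group of dimension $d$ with Lie algebra $\mathfrak g$, acting smoothly on $M$ and preserving $\omega$ and $J$. Let $X^\xi$ denote the vector field of the infinitesimal action of $\xi\in\mathfrak g$, and let $\Phi:M\to\mathfrak g^*$, $\Phi(x)(\xi)=\phi_\xi(x)$, be an equivariant moment map, so $\mathfrak i(X^\xi)\omega=d\phi_\xi$. Assume that $0$ is a regular value of $\Phi$ and that $G$ acts freely on $\Phi^{-1}(0)$, and let $M/\!\!/G=\Phi^{-1}(0)/G$ be the Kähler quotient, with reduced symplectic form $\widehat\omega$ and with $T^{1,0}(M/\!\!/G)=\pi_*(T^{\mathbb C}\Phi^{-1}(0)\cap T^{1,0}M)$, where $\pi:\Phi^{-1}(0)\to M/\!\!/G$ is the quotient map. Let $\ell$ be a Hermitian line bundle on $M$ with compatible connection $\nabla$ of curvature $-i\omega$, with a lift of the $G$-action to $\ell$ by unitary bundle maps which exponentiates the action $\nabla_{X^\xi}-i\phi_\xi$ of $\mathfrak g$ on sections. Let $\sqrt K$ be a square root of the canonical bundle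 $K$ of $M$ with a $G$-action compatible with that on $K$. Let $\widehat\ell$ be the Hermitian line bundle $(\ell|_{\Phi^{-1}(0)})/G$ on $M/\!\!/G$. Fix an $\mathrm{Ad}$-invariant inner product on $\mathfrak g$ for which the associated Haar measure (the Riemannian volume of the left invariant metric) gives $G$ volume $1$, and an orthonormal basis $\xi_1,\dots,\xi_d$ of $\mathfrak g$. Let $\sqrt{\widehat K}=(\sqrt K|_{\Phi^{-1}(0)})/G$, made into a square root of the canonical bundle $\widehat K$ of $M/\!\!/G$ as follows: for a $G$-invariant section $\nu$ of $\sqrt K$, let $B\nu$ be the section of $\sqrt{\widehat K}$ to which $\nu|_{\Phi^{-1}(0)}$ descends; its square $(B\nu)^2$ is the $(n-d,0)$-form on $M/\!\!/G$ with $$\pi^*\big[(B\nu)^2\big]=\big[\nu^2(X^{\xi_1},\dots,X^{\xi_d},\cdot,\dots,\cdot)\big]\big|_{\Phi^{-1}(0)}.$$ For $k\ge 0$ let $B_k$ be the induced map from $G$-invariant sections of $\ell^{\otimes k}\otimes\sqrt K$ over $M$ to sections of $\widehat\ell^{\otimes k}\otimes\sqrt{\widehat K}$ over $M/\!\!/G$: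 it sends $s\otimes\nu$ to $A_ks\otimes B\nu$, where $A_ks$ is the section to which $s|_{\Phi^{-1}(0)}$ descends. The pointwise magnitude of a half-form $\nu$ on $M$ is the number $|\nu|^2\ge0$ for which $\nu^2\wedge\overline{\nu}^{\,2}$ equals $(|\nu|^2)^2\,\omega^{\wedge n}/n!$ up to a unimodular constant depending only on $n$; for half-forms on $M/\!\!/G$ it is defined in the same way by $\widehat\omega^{\wedge(n-d)}/(n-d)!$. For $s\otimes\nu$ one puts $|s\otimes\nu|^2=|s|^2|\nu|^2$. Theorem. Let $r$ be a $G$-invariant holomorphic section of $\ell^{\otimes k}\otimes\sqrt K$ (locally $r=f\,s^{\otimes k}\otimes\nu$ with $f$ a holomorphic function, $s$ a nowhere vanishing section of $\ell$ with $\nabla_{\bar Z}s=0$ for all $\bar Z$ of type $(0,1)$, and $\nu$ a nowhere vanishing section of $\sqrt K$ such that $\nu^2$ is a holomorphic $(n,0)$-form). Then for every $x_0\in\Phi^{-1}(0)$ $$|B_kr|^2([x_0])=2^{-d/2}\,\mathrm{vol}(G\cdot x_0)\,|r|^2(x_0),$$ where $\mathrm{vol}(G\cdot x_0)$ is the $d$-dimensional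 Riemannian volume of the orbit with respect to the metric induced from $M$. -/

import Mathlib

open scoped Manifold ContDiff TensorProduct ComplexConjugate
open Bundle

noncomputable section

namespace GeomQuant

/-! ### Linear algebra of top-degree forms

A `2n`-form is evaluated on a family of `2n` vectors, indexed by `Fin n ⊕ Fin n`. -/

section LinearAlgebra

/-- The Liouville form `ω^{∧ n} / n!` of a skew bilinear form `ω`, evaluated on `2n` vectors
(`ω^{∧ n}` is the wedge power in the convention `(ω ∧ η)(u, v, …) = ω(u, v) η(…) ± …`). -/
def liouville {V : Type*} (n : ℕ) (w₂ : V → V → ℝ) (v : Fin n ⊕ Fin n → V) : ℝ :=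
  (∑ σ : Equiv.Perm (Fin n ⊕ Fin n), ((Equiv.Perm.sign σ : ℤ) : ℝ) *
    ∏ i : Fin n, w₂ (v (σ (Sum.inl i))) (v (σ (Sum.inr i)))) / (2 ^ n * (n.factorial : ℝ))

/-- The wedge product `α ∧ conj α` of a complex valued `n`-form with its conjugate, evaluated on
`2n` vectors. -/
def wedgeConj {V : Type*} (n : ℕ) (α : (Fin n → V) → ℂ) (v : Fin n ⊕ Fin n → V) : ℂ :=
  (∑ σ : Equiv.Perm (Fin n ⊕ Fin n), ((Equiv.Perm.sign σ : ℤ) : ℂ) *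
    (α (fun i => v (σ (Sum.inl i))) * conj (α (fun i => v (σ (Sum.inr i)))))) /
      ((n.factorial : ℂ) * (n.factorial : ℂ))

/-- The pointwise magnitude `|ν|²` of a half-form `ν` whose square is the `(n,0)`-form `α`: the
number `t ≥ 0` such that `α ∧ conj α` is `t²` times the Liouville form `ω^{∧ n} / n!`, up to a
unimodular constant which depends only on `n`. (For symplectic `ω` there is exactly one such `t`;
the infimum just selects it.) -/
def halfFormMag {V : Type*} (n : ℕ) (w₂ : V → V → ℝ) (α : (Fin n → V) → ℂ) : ℝ :=
  sInf {t : ℝ | 0 ≤ t ∧ ∀ v : Fin n ⊕ Fin n → V, ‖wedgeConj n α v‖ = t ^ 2 * |liouville n w₂ v|}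

/-- The pointwise magnitude on `V^{⊗ k} ⊗ W`, for complex lines `V` and `W` with magnitudes
`a v = |v|²` and `b w = |w|²`: the magnitude of `v^{⊗ k} ⊗ w` is `(a v)^k * b w`.
(Every element is of this form, and the set below has exactly one element.) -/
def tensorMag {V W : Type*} [AddCommGroup V] [Module ℂ V] [AddCommGroup W] [Module ℂ W]
    (a : V → ℝ) (b : W → ℝ) (k : ℕ) (t : (⨂[ℂ]^k V) ⊗[ℂ] W) : ℝ :=
  sInf {c : ℝ | ∃ (v : V) (w : W),
    t = (PiTensorProduct.tprod ℂ fun _ : Fin k => v) ⊗ₜ[ℂ] w ∧ c = a v ^ k * b w}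

lemma append_update_right {V : Type*} {d m : ℕ} (X : Fin d → V) (Y : Fin m → V) (i : Fin m)
    (y : V) : Fin.append X (Function.update Y i y) =
      Function.update (Fin.append X Y) (Fin.natAdd d i) y := by
  funext j
  refine Fin.addCases (fun a => ?_) (fun b => ?_) j
  · have h : Fin.castAdd m a ≠ Fin.natAdd d i := by
      intro h
      have h2 := congrArg Fin.val h
      simp only [Fin.val_castAdd, Fin.val_natAdd] at h2
      have := a.2
      omega
    simp [Function.update_of_ne h]
  · by_cases hb : b = i
    · subst hb
      simp
    · have h : Fin.natAdd d b ≠ Fin.natAdd d i := by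
        intro h
        exact hb (Fin.natAdd_injective _ _ h)
      simp [Function.update_of_ne h, Function.update_of_ne hb]

/-- The contraction `i(X₁ ∧ … ∧ X_d) α = α(X₁, …, X_d, ·, …, ·)`. -/
def contract {V : Type*} [AddCommGroup V] [Module ℂ V] {d m : ℕ} (X : Fin d → V)
    (α : V [⋀^Fin (d + m)]→ₗ[ℂ] ℂ) : V [⋀^Fin m]→ₗ[ℂ] ℂ where
  toFun Y := α (Fin.append X Y)
  map_update_add' := by
    intro inst Y i y z
    obtain rfl : inst = instDecidableEqFin m := Subsingleton.elim _ _
    simp only [append_update_right, AlternatingMap.map_update_add]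
  map_update_smul' := by
    intro inst Y i c y
    obtain rfl : inst = instDecidableEqFin m := Subsingleton.elim _ _
    simp only [append_update_right, AlternatingMap.map_update_smul]
  map_eq_zero_of_eq' := by
    intro Y i j hij hne
    refine α.map_eq_zero_of_eq _ (i := Fin.natAdd d i) (j := Fin.natAdd d j) ?_ ?_
    · simpa using hij
    · intro h
      exact hne (Fin.natAdd_injective _ _ h)

/-- The maximal complex subspace of the common kernel of a family of real linear functionals. -/
def maxComplexSubspace {V ι : Type*} [NormedAddCommGroup V] [NormedSpace ℂ V]
    (D : ι → V →L[ℝ] ℝ) : Submodule ℂ V where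
  carrier := {v | ∀ i, D i v = 0 ∧ D i (Complex.I • v) = 0}
  add_mem' := by
    intro v w hv hw i
    obtain ⟨h1, h2⟩ := hv i
    obtain ⟨h3, h4⟩ := hw i
    rw [smul_add, map_add, map_add, h1, h2, h3, h4]
    simp
  zero_mem' := by
    intro i
    simp
  smul_mem' := by
    intro c v hv i
    obtain ⟨h1, h2⟩ := hv i
    have e1 : c • v = c.re • v + c.im • (Complex.I • v) := by
      conv_lhs => rw [← Complex.re_add_im c, add_smul, mul_smul]
      rfl
    have e2 : Complex.I • c • v = c.re • (Complex.I • v) - c.im • v := by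
      rw [e1, smul_add, smul_comm Complex.I c.re, smul_comm Complex.I c.im, smul_smul Complex.I,
        Complex.I_mul_I, neg_one_smul, smul_neg, sub_eq_add_neg]
    constructor
    · rw [e1, map_add, map_smul (D i) c.re, map_smul (D i) c.im, h1, h2]
      simp
    · rw [e2, map_sub, map_smul (D i) c.re, map_smul (D i) c.im, h1, h2]
      simp

end LinearAlgebra

/-! ### Riemannian volume -/

section Volume

variable {d : ℕ} {N : Type*} [TopologicalSpace N] [ChartedSpace (EuclideanSpace ℝ (Fin d)) N]

/-- The Riemannian density `√(det g_{ij})` in the chart around `c`, at the point `u` of the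
target of that chart. -/
def chartDensity (g : ∀ y : N, TangentSpace 𝓘(ℝ, EuclideanSpace ℝ (Fin d)) y →
      TangentSpace 𝓘(ℝ, EuclideanSpace ℝ (Fin d)) y → ℝ)
    (c : N) (u : EuclideanSpace ℝ (Fin d)) : ℝ :=
  let e := extChartAt 𝓘(ℝ, EuclideanSpace ℝ (Fin d)) c
  let D : Fin d → TangentSpace 𝓘(ℝ, EuclideanSpace ℝ (Fin d)) (e.symm u) := fun i =>
    mfderiv 𝓘(ℝ, EuclideanSpace ℝ (Fin d)) 𝓘(ℝ, EuclideanSpace ℝ (Fin d)) e.symm u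
      (EuclideanSpace.single i (1 : ℝ))
  Real.sqrt (Matrix.det (Matrix.of fun i j : Fin d => g (e.symm u) (D i) (D j)))

/-- The total Riemannian volume of a second countable `d`-manifold `N` with Riemannian metric `g`:
the infimum, over all countable covers of `N` by measurable pieces of charts, of the sum of the
volumes `∫ √(det g_{ij}) du` of the pieces. (The infimum is attained when the pieces are
disjoint.) -/
def riemVolume (g : ∀ y : N, TangentSpace 𝓘(ℝ, EuclideanSpace ℝ (Fin d)) y →
      TangentSpace 𝓘(ℝ, EuclideanSpace ℝ (Fin d)) y → ℝ) : ENNReal :=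
  ⨅ p : {p : ℕ → N × Set (EuclideanSpace ℝ (Fin d)) //
      (∀ i, MeasurableSet (p i).2 ∧
        (p i).2 ⊆ (extChartAt 𝓘(ℝ, EuclideanSpace ℝ (Fin d)) (p i).1).target) ∧
      (⋃ i, (extChartAt 𝓘(ℝ, EuclideanSpace ℝ (Fin d)) (p i).1).symm '' (p i).2) = Set.univ},
    ∑' i, ∫⁻ u in (p.1 i).2, ENNReal.ofReal (chartDensity g (p.1 i).1 u)

end Volume

/-! ### Lie groups -/

section LieGroups

variable (d : ℕ) (G : Type*) [TopologicalSpace G] [ChartedSpace (EuclideanSpace ℝ (Fin d)) G]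
  [Group G]

/-- The Lie algebra of `G`. -/
abbrev LieAlg : Type := GroupLieAlgebra 𝓘(ℝ, EuclideanSpace ℝ (Fin d)) G

variable {G}

/-- The adjoint action of `G` on its Lie algebra. -/
def Ad (g : G) (ξ : LieAlg d G) : LieAlg d G :=
  mfderiv 𝓘(ℝ, EuclideanSpace ℝ (Fin d)) 𝓘(ℝ, EuclideanSpace ℝ (Fin d))
    (fun h : G => g * h * g⁻¹) 1 ξ

/-- The left invariant metric on `G` given by a bilinear form on the Lie algebra. -/
def leftInvMetric (b : LieAlg d G →ₗ[ℝ] LieAlg d G →ₗ[ℝ] ℝ) (g : G)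
    (v w : TangentSpace 𝓘(ℝ, EuclideanSpace ℝ (Fin d)) g) : ℝ :=
  let D : TangentSpace 𝓘(ℝ, EuclideanSpace ℝ (Fin d)) g → LieAlg d G := fun u =>
    mfderiv 𝓘(ℝ, EuclideanSpace ℝ (Fin d)) 𝓘(ℝ, EuclideanSpace ℝ (Fin d))
      (fun h : G => g⁻¹ * h) g u
  b (D v) (D w)

variable (G)

/-- An `Ad`-invariant inner product on the Lie algebra, normalized so that the associated Haar
measure (the Riemannian volume of the left invariant metric) gives `G` volume `1`. -/
structure NormalizedInnerProduct where
  form : LieAlg d G →ₗ[ℝ] LieAlg d G →ₗ[ℝ] ℝ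
  symm : ∀ ξ η, form ξ η = form η ξ
  pos : ∀ ξ, ξ ≠ 0 → 0 < form ξ ξ
  ad_invariant : ∀ g ξ η, form (Ad d g ξ) (Ad d g η) = form ξ η
  volume_eq_one : riemVolume (leftInvMetric d form) = 1

end LieGroups

/-! ### Kähler manifolds

A complex manifold `M` is modelled on the complex vector space `E`; its real tangent spaces are
`TangentSpace 𝓘(ℝ, E) x`, and `TangentSpace 𝓘(ℂ, E) x` is the same space, regarded as a complex
vector space by means of the complex structure `J`. Thus the `(p,0)`-forms at `x` are the
complex multilinear alternating `p`-forms on `TangentSpace 𝓘(ℂ, E) x`. -/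

section Kahler

variable {E : Type*} [NormedAddCommGroup E] [NormedSpace ℂ E]
variable {M : Type*} [TopologicalSpace M] [ChartedSpace E M]

/-- The complex structure `J` on the tangent spaces. -/
def complexJ (x : M) (v : TangentSpace 𝓘(ℝ, E) x) : TangentSpace 𝓘(ℝ, E) x :=
  let v' : E := v
  (Complex.I • v' : E)

/-- The derivative of the inverse of the chart around `c`, at the point `u` of its target. -/
def chartPush (c : M) (u : E) (v : E) :
    TangentSpace 𝓘(ℝ, E) ((extChartAt 𝓘(ℝ, E) c).symm u) :=
  mfderiv 𝓘(ℝ, E) 𝓘(ℝ, E) (extChartAt 𝓘(ℝ, E) c).symm u v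

/-- The expression of a 2-form in the chart around `c`. -/
def chartForm
    (w₂ : ∀ x : M, TangentSpace 𝓘(ℝ, E) x →ₗ[ℝ] TangentSpace 𝓘(ℝ, E) x →ₗ[ℝ] ℝ)
    (c : M) (v w : E) (u : E) : ℝ :=
  w₂ ((extChartAt 𝓘(ℝ, E) c).symm u) (chartPush c u v) (chartPush c u w)

variable (E M)

/-- A Kähler form `ω` on a complex manifold: a smooth closed 2-form of type `(1,1)` such that
`B = ω(·, J ·)` is positive definite. -/
structure KahlerForm where
  form : ∀ x : M, TangentSpace 𝓘(ℝ, E) x →ₗ[ℝ] TangentSpace 𝓘(ℝ, E) x →ₗ[ℝ] ℝ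
  alt : ∀ x v, form x v v = 0
  smooth : ∀ (c : M) (v w : E),
    ContDiffOn ℝ ∞ (chartForm form c v w) (extChartAt 𝓘(ℝ, E) c).target
  closed : ∀ (c : M), ∀ u ∈ (extChartAt 𝓘(ℝ, E) c).target, ∀ a b e : E,
    fderiv ℝ (chartForm form c b e) u a + fderiv ℝ (chartForm form c e a) u b +
      fderiv ℝ (chartForm form c a b) u e = 0
  J_invariant : ∀ x v w, form x (complexJ x v) (complexJ x w) = form x v w
  pos : ∀ x v, v ≠ 0 → 0 < form x v (complexJ x v)

variable {E M}

/-- The Riemannian metric `B = ω(·, J ·)`. -/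
def KahlerForm.metric (K : KahlerForm E M) (x : M) (v w : TangentSpace 𝓘(ℝ, E) x) : ℝ :=
  K.form x v (complexJ x w)

/-- An `(n,0)`-form is holomorphic on `U` if in every holomorphic chart its coefficients are
holomorphic functions. -/
def HolomorphicFormOn {n : ℕ}
    (α : ∀ x : M, TangentSpace 𝓘(ℂ, E) x [⋀^Fin n]→ₗ[ℂ] ℂ) (U : Set M) : Prop :=
  ∀ (c : M) (v : Fin n → E), DifferentiableOn ℂ
    (fun u : E => α ((extChartAt 𝓘(ℂ, E) c).symm u) fun i =>
      mfderiv 𝓘(ℂ, E) 𝓘(ℂ, E) (extChartAt 𝓘(ℂ, E) c).symm u (v i))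
    ((extChartAt 𝓘(ℂ, E) c).target ∩ (extChartAt 𝓘(ℂ, E) c).symm ⁻¹' U)

/-- An `(n,0)`-form is smooth if in every holomorphic chart its coefficients are smooth. -/
def SmoothForm {n : ℕ}
    (α : ∀ x : M, TangentSpace 𝓘(ℂ, E) x [⋀^Fin n]→ₗ[ℂ] ℂ) : Prop :=
  ∀ (c : M) (v : Fin n → E), ContDiffOn ℝ ∞
    (fun u : E => α ((extChartAt 𝓘(ℂ, E) c).symm u) fun i =>
      mfderiv 𝓘(ℂ, E) 𝓘(ℂ, E) (extChartAt 𝓘(ℂ, E) c).symm u (v i))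
    (extChartAt 𝓘(ℂ, E) c).target

/-- A complex manifold is a smooth manifold. -/
instance isManifold_real [IsManifold 𝓘(ℂ, E) ω M] : IsManifold 𝓘(ℝ, E) ∞ M := by
  refine isManifold_of_contDiffOn 𝓘(ℝ, E) ∞ M ?_
  intro e e' he he'
  have h := (contDiffGroupoid ω 𝓘(ℂ, E)).compatible he he'
  have h2 := (contDiffGroupoid_le (I := 𝓘(ℂ, E)) (m := ∞) (n := ω) le_top) h
  have h3 := (mem_groupoid_of_pregroupoid.mp
    (show e.symm ≫ₕ e' ∈ (contDiffPregroupoid ∞ 𝓘(ℂ, E)).groupoid from h2)).1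
  simp only [contDiffPregroupoid, modelWithCornersSelf_coe, modelWithCornersSelf_coe_symm,
    Function.id_comp, Function.comp_id, Set.preimage_id, Set.range_id, Set.inter_univ] at h3 ⊢
  exact h3.restrict_scalars ℝ

/-! ### Hamiltonian actions and the zero set of the moment map -/

variable {d : ℕ} {G : Type*} [TopologicalSpace G] [ChartedSpace (EuclideanSpace ℝ (Fin d)) G]
  [Group G] [MulAction G M]

/-- The vector field `X^ξ` of the infinitesimal action, `X^ξ(x) = d/dt (e^{tξ} · x)` at `t = 0`,
i.e. the image of `ξ` under the derivative at `1` of `g ↦ g · x`. -/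
def infAction (ξ : LieAlg d G) (x : M) : TangentSpace 𝓘(ℝ, E) x :=
  mfderiv 𝓘(ℝ, EuclideanSpace ℝ (Fin d)) 𝓘(ℝ, E) (fun g : G => g • x) 1 ξ

/-- The derivative of the action of `g`, as a real linear map. -/
def pushReal (g : G) (x : M) (v : TangentSpace 𝓘(ℝ, E) x) : TangentSpace 𝓘(ℝ, E) (g • x) :=
  mfderiv 𝓘(ℝ, E) 𝓘(ℝ, E) (fun y : M => g • y) x v

/-- The derivative of the (holomorphic) action of `g`, as a complex linear map. -/
def pushComplex (g : G) (x : M) :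
    TangentSpace 𝓘(ℂ, E) x →ₗ[ℂ] TangentSpace 𝓘(ℂ, E) (g • x) :=
  (mfderiv 𝓘(ℂ, E) 𝓘(ℂ, E) (fun y : M => g • y) x).toLinearMap

variable (d G)

/-- A Hamiltonian action of `G` on the Kähler manifold `M` by holomorphic isometries, with
equivariant moment map `Φ`, such that `0` is a regular value of `Φ` and `G` acts freely on
`Φ⁻¹(0)`. -/
structure HamiltonianAction (K : KahlerForm E M) where
  holomorphic : ∀ g : G, MDifferentiable 𝓘(ℂ, E) 𝓘(ℂ, E) (fun x : M => g • x)
  symplectic : ∀ (g : G) (x : M) (v w : TangentSpace 𝓘(ℝ, E) x),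
    K.form (g • x) (pushReal g x v) (pushReal g x w) = K.form x v w
  Φ : M → Module.Dual ℝ (LieAlg d G)
  smooth : ∀ ξ, ContMDiff 𝓘(ℝ, E) 𝓘(ℝ, ℝ) ∞ fun x => Φ x ξ
  hamiltonian : ∀ ξ x (v : TangentSpace 𝓘(ℝ, E) x),
    K.form x (infAction ξ x) v = mvfderiv 𝓘(ℝ, E) (fun y => Φ y ξ) x v
  equivariant : ∀ (g : G) x ξ, Φ (g • x) ξ = Φ x (Ad d g⁻¹ ξ)
  regular : ∀ x, Φ x = 0 → ∀ l : Module.Dual ℝ (LieAlg d G),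
    ∃ v : TangentSpace 𝓘(ℝ, E) x, ∀ ξ, mvfderiv 𝓘(ℝ, E) (fun y => Φ y ξ) x v = l ξ
  free : ∀ x, Φ x = 0 → ∀ g : G, g • x = x → g = 1

variable {d G}

/-- The Riemannian volume of the orbit `G · x`, for `x` with trivial stabilizer: the volume of `G`
with respect to the pullback of the metric of `M` under the injective immersion `g ↦ g · x` onto
the orbit. -/
def orbitVolume (d : ℕ) (G : Type*) [TopologicalSpace G]
    [ChartedSpace (EuclideanSpace ℝ (Fin d)) G] [Group G] [MulAction G M]
    (K : KahlerForm E M) (x : M) : ℝ :=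
  (riemVolume (d := d) (N := G) fun g v w =>
    K.metric (g • x)
      (mfderiv 𝓘(ℝ, EuclideanSpace ℝ (Fin d)) 𝓘(ℝ, E) (fun h : G => h • x) g v)
      (mfderiv 𝓘(ℝ, EuclideanSpace ℝ (Fin d)) 𝓘(ℝ, E) (fun h : G => h • x) g w)).toReal

namespace HamiltonianAction

variable {K : KahlerForm E M} (H : HamiltonianAction d G K)

/-- The zero set `Φ⁻¹(0)`, with its `G`-action. -/
def zeroSet : SubMulAction G M where
  carrier := {x | H.Φ x = 0}
  smul_mem' := by
    intro g x hx
    ext ξ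
    rw [H.equivariant, show H.Φ x = 0 from hx]
    rfl

/-- The symplectic quotient `M // G = Φ⁻¹(0) / G`. -/
def Reduced : Type _ := MulAction.orbitRel.Quotient G H.zeroSet

/-- The quotient map `Φ⁻¹(0) → M // G`. -/
def proj (x : H.zeroSet) : H.Reduced := Quotient.mk (MulAction.orbitRel G H.zeroSet) x

lemma proj_smul (g : G) (x : H.zeroSet) : H.proj (g • x) = H.proj x :=
  Quotient.sound (s := MulAction.orbitRel G H.zeroSet) ⟨g, rfl⟩

lemma exists_smul_eq {x y : H.zeroSet} (h : H.proj x = H.proj y) : ∃ g : G, g • x = y := by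
  obtain ⟨g, hg⟩ := Quotient.exact (s := MulAction.orbitRel G H.zeroSet) h.symm
  exact ⟨g, hg⟩

/-- The `G`-orbit in `Φ⁻¹(0)` over a point `q` of the quotient. -/
def Orbit (q : H.Reduced) : Type _ := {x : H.zeroSet // H.proj x = q}

variable {H}

/-- The underlying point of `M`. -/
def Orbit.pt {q : H.Reduced} (x : H.Orbit q) : M := (x.1 : M)

/-- The action of `G` on an orbit. -/
def Orbit.move {q : H.Reduced} (g : G) (x : H.Orbit q) : H.Orbit q :=
  ⟨g • x.1, (H.proj_smul g x.1).trans x.2⟩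

/-- A representative of a point of the quotient. -/
def Orbit.rep (q : H.Reduced) : H.Orbit q :=
  ⟨Quotient.out q, Quotient.out_eq q⟩

end HamiltonianAction

/-! ### Equivariant vector bundles and their descent to the quotient -/

/-- A smooth action of `G` on the total space of the complex line bundle `L` by fibrewise linear
maps covering the action on `M`. -/
structure BundleAction (d : ℕ) (G : Type*) [TopologicalSpace G]
    [ChartedSpace (EuclideanSpace ℝ (Fin d)) G] [Group G] [MulAction G M]
    (L : M → Type*) [∀ x, AddCommGroup (L x)] [∀ x, Module ℂ (L x)]
    [∀ x, TopologicalSpace (L x)] [TopologicalSpace (TotalSpace ℂ L)] [FiberBundle ℂ L] where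
  map : ∀ (g : G) (x : M), L x →ₗ[ℂ] L (g • x)
  map_one : ∀ (x : M) (v : L x),
    (⟨(1 : G) • x, map 1 x v⟩ : TotalSpace ℂ L) = ⟨x, v⟩
  map_mul : ∀ (g h : G) (x : M) (v : L x),
    (⟨(g * h) • x, map (g * h) x v⟩ : TotalSpace ℂ L) = ⟨g • h • x, map g (h • x) (map h x v)⟩
  smooth : ContMDiff (𝓘(ℝ, EuclideanSpace ℝ (Fin d)).prod (𝓘(ℝ, E).prod 𝓘(ℝ, ℂ)))
    (𝓘(ℝ, E).prod 𝓘(ℝ, ℂ)) ∞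
    (fun p : G × TotalSpace ℂ L => (⟨p.1 • p.2.1, map p.1 p.2.1 p.2.2⟩ : TotalSpace ℂ L))

namespace HamiltonianAction

variable {K : KahlerForm E M} (H : HamiltonianAction d G K)

/-- The fibre at `q ∈ M // G` of the bundle `(L|_{Φ⁻¹(0)}) / G`: its elements are the
`G`-equivariant families of vectors of `L` along the orbit `q`. -/
def descend {L : M → Type*} [∀ x, AddCommGroup (L x)] [∀ x, Module ℂ (L x)]
    (ρ : ∀ (g : G) (x : M), L x →ₗ[ℂ] L (g • x)) (q : H.Reduced) :
    Submodule ℂ (∀ x : H.Orbit q, L x.pt) where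
  carrier := {v | ∀ (g : G) (x : H.Orbit q), ρ g x.pt (v x) = v (x.move g)}
  add_mem' := by
    intro v w hv hw g x
    simp only [Set.mem_ofPred_eq, Pi.add_apply, _root_.map_add] at hv hw ⊢
    exact congrArg₂ (· + ·) (hv g x) (hw g x)
  zero_mem' := by
    intro g x
    simp only [Pi.zero_apply, _root_.map_zero]
    rfl
  smul_mem' := by
    intro c v hv g x
    simp only [Set.mem_ofPred_eq, Pi.smul_apply, _root_.map_smul] at hv ⊢
    exact congrArg (c • ·) (hv g x)

/-- Evaluation of a descended vector at a point of the orbit. -/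
def evalAt {L : M → Type*} [∀ x, AddCommGroup (L x)] [∀ x, Module ℂ (L x)]
    (ρ : ∀ (g : G) (x : M), L x →ₗ[ℂ] L (g • x)) {q : H.Reduced} (x : H.Orbit q) :
    H.descend ρ q →ₗ[ℂ] L x.pt :=
  (LinearMap.proj x).comp (Submodule.subtype _)

section Line

variable {L : M → Type*} [∀ x, AddCommGroup (L x)] [∀ x, Module ℂ (L x)]
  [∀ x, TopologicalSpace (L x)] [TopologicalSpace (TotalSpace ℂ L)] [FiberBundle ℂ L]
  (A : BundleAction (E := E) d G L)

lemma evalAt_bijective {q : H.Reduced} (x : H.Orbit q) :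
    Function.Bijective (H.evalAt A.map x) := by
  classical
  have hex : ∀ y : H.Orbit q, ∃ g : G, x.move g = y := by
    intro y
    obtain ⟨g, hg⟩ := H.exists_smul_eq (x.2.trans y.2.symm)
    exact ⟨g, Subtype.ext hg⟩
  have huniq : ∀ g h : G, x.move g = x.move h → g = h := by
    intro g h hgh
    have h1 : g • x.pt = h • x.pt := congrArg HamiltonianAction.Orbit.pt hgh
    have h2 : (h⁻¹ * g) • x.pt = x.pt := by
      rw [mul_smul, h1, inv_smul_smul]
    have h3 := H.free x.pt x.1.2 _ h2
    exact (inv_mul_eq_one.mp h3).symm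
  constructor
  · rw [injective_iff_map_eq_zero]
    intro v hv
    have hv' : v.1 x = 0 := hv
    apply Subtype.ext
    funext y
    obtain ⟨g, rfl⟩ := hex y
    have h4 := v.2 g x
    rw [hv', _root_.map_zero] at h4
    exact h4.symm
  · intro w
    choose γ hγ using hex
    let f : ∀ y : H.Orbit q, L y.pt := fun y => (hγ y) ▸ (A.map (γ y) x.pt w)
    have hf : ∀ (y : H.Orbit q) (g : G), x.move g = y →
        (⟨y.pt, f y⟩ : TotalSpace ℂ L) = ⟨g • x.pt, A.map g x.pt w⟩ := by
      intro y g hg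
      have hgy : g = γ y := huniq _ _ (hg.trans (hγ y).symm)
      subst hgy
      have key : ∀ (z : H.Orbit q) (hz : x.move (γ y) = z),
          (⟨z.pt, (hz ▸ (show L (x.move (γ y)).pt from A.map (γ y) x.pt w) : L z.pt)⟩ :
            TotalSpace ℂ L) = ⟨γ y • x.pt, A.map (γ y) x.pt w⟩ := by
        intro z hz
        subst hz
        rfl
      exact key y (hγ y)
    have hmap : ∀ (g : G) (p p' : TotalSpace ℂ L), p = p' →
        (⟨g • p.1, A.map g p.1 p.2⟩ : TotalSpace ℂ L) = ⟨g • p'.1, A.map g p'.1 p'.2⟩ := by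
      rintro g p p' rfl
      rfl
    refine ⟨⟨f, ?_⟩, ?_⟩
    · intro g y
      have h5 := hmap g _ _ (hf y (γ y) (hγ y))
      have h6 : x.move (g * γ y) = y.move g := by
        apply Subtype.ext
        have := congrArg Subtype.val (hγ y)
        change (g * γ y) • x.1 = g • y.1
        rw [mul_smul]
        exact congrArg (g • ·) this
      have h7 := hf (y.move g) (g * γ y) h6
      rw [A.map_mul] at h7
      have h8 := h5.trans h7.symm
      exact TotalSpace.mk_injective (F := ℂ) (E := L) (g • y.pt) h8
    · have h9 := hf x 1 (by
        apply Subtype.ext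
        exact one_smul G x.1)
      rw [A.map_one] at h9
      exact TotalSpace.mk_injective (F := ℂ) (E := L) x.pt h9

/-- The fibre at `q` of the descended bundle is identified with the fibre of the original bundle
at any point of the orbit `q`. -/
def evalEquiv {q : H.Reduced} (x : H.Orbit q) : H.descend A.map q ≃ₗ[ℂ] L x.pt :=
  LinearEquiv.ofBijective (H.evalAt A.map x) (H.evalAt_bijective A x)

end Line

/-! ### The Kähler structure of the quotient -/

/-- The maximal complex subspace `T_x Φ⁻¹(0) ∩ J T_x Φ⁻¹(0)` of the tangent space
`T_x Φ⁻¹(0) = ker dΦ_x` of the zero set; equivalently, the space of the real parts of the vectors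
in `T^{1,0} M ∩ T^ℂ Φ⁻¹(0)`. -/
def horizontal (x : M) : Submodule ℂ (TangentSpace 𝓘(ℂ, E) x) :=
  maxComplexSubspace (V := E) fun ξ : LieAlg d G => (mvfderiv 𝓘(ℝ, E) (fun y => H.Φ y ξ) x : E →L[ℝ] ℝ)

/-- The tangent space of `M // G` at `q`, with its complex structure. The derivative of the
quotient map identifies it with `T_x Φ⁻¹(0) ∩ J T_x Φ⁻¹(0)` for every `x` in the orbit `q`, and
these identifications are intertwined by the action of `G`. -/
def tangent (q : H.Reduced) :
    Submodule ℂ (H.descend (L := fun x : M => TangentSpace 𝓘(ℂ, E) x) pushComplex q) where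
  carrier := {Y | ∀ x : H.Orbit q, Y.1 x ∈ H.horizontal x.pt}
  add_mem' := fun hv hw x => (H.horizontal x.pt).add_mem (hv x) (hw x)
  zero_mem' := fun x => (H.horizontal x.pt).zero_mem
  smul_mem' := fun c _ hv x => (H.horizontal x.pt).smul_mem c (hv x)

/-- The horizontal lift of a tangent vector of `M // G` to a point of the orbit. -/
def lift {q : H.Reduced} (x : H.Orbit q) : H.tangent q →ₗ[ℂ] TangentSpace 𝓘(ℂ, E) x.pt :=
  (H.evalAt (L := fun x : M => TangentSpace 𝓘(ℂ, E) x) pushComplex x).comp (Submodule.subtype _)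

/-- The reduced symplectic form, `π^* ω_red = i^* ω`. -/
def reducedForm (q : H.Reduced) (Y Z : H.tangent q) : ℝ :=
  K.form (Orbit.rep q).pt (H.lift (Orbit.rep q) Y) (H.lift (Orbit.rep q) Z)

/-- The descent of an `(n,0)`-form to an `(n-d,0)`-form on the quotient, at the point `q`: contract
with `X^{ξ_1} ∧ … ∧ X^{ξ_d}`, restrict to the zero set and let the result descend. Here the form
is given by its value at the chosen point of the orbit `q`. -/
def descendForm {m : ℕ} (Ξ : Fin d → LieAlg d G) {q : H.Reduced} (x : H.Orbit q)
    (α : TangentSpace 𝓘(ℂ, E) x.pt [⋀^Fin (d + m)]→ₗ[ℂ] ℂ) :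
    H.tangent q [⋀^Fin m]→ₗ[ℂ] ℂ :=
  (contract (V := TangentSpace 𝓘(ℂ, E) x.pt)
    (fun j => (infAction (Ξ j) x.pt : TangentSpace 𝓘(ℝ, E) x.pt)) α).compLinearMap (H.lift x)

end HamiltonianAction

/-! ### The prequantum bundle and the half-form bundle -/

section Bundles

variable [IsManifold 𝓘(ℂ, E) ω M]
variable {K : KahlerForm E M} (H : HamiltonianAction d G K)

/-- Smooth sections of a complex line bundle. -/
def SmoothOn (L : M → Type*) [∀ x, TopologicalSpace (L x)]
    [TopologicalSpace (TotalSpace ℂ L)] [FiberBundle ℂ L] (U : Set M) (s : ∀ x, L x) : Prop :=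
  ContMDiffOn 𝓘(ℝ, E) (𝓘(ℝ, E).prod 𝓘(ℝ, ℂ)) ∞ (fun x => TotalSpace.mk' ℂ x (s x)) U

/-- Smooth vector fields. -/
def SmoothField (X : ∀ x : M, TangentSpace 𝓘(ℝ, E) x) : Prop :=
  ContMDiff 𝓘(ℝ, E) (𝓘(ℝ, E).prod 𝓘(ℝ, E)) ∞
    (fun x => (⟨x, X x⟩ : TotalSpace E (fun y : M => TangentSpace 𝓘(ℝ, E) y)))

/-- The structure of a `G`-equivariant prequantum bundle on the smooth complex line bundle `L`:
a Hermitian form `h` (linear in the second factor), a compatible connection `∇` with curvature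
`-iω`, and an action of `G` by unitary bundle maps, which exponentiates the action
`∇_{X^ξ} - i φ_ξ` of the Lie algebra on sections. -/
structure Prequantum (L : M → Type*) [∀ x, AddCommGroup (L x)] [∀ x, Module ℂ (L x)]
    [∀ x, TopologicalSpace (L x)] [∀ x, IsTopologicalAddGroup (L x)]
    [∀ x, ContinuousSMul ℝ (L x)]
    [TopologicalSpace (TotalSpace ℂ L)] [FiberBundle ℂ L] where
  h : ∀ x : M, L x →ₗ⋆[ℂ] L x →ₗ[ℂ] ℂ
  h_symm : ∀ x v w, conj (h x v w) = h x w v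
  h_pos : ∀ x v, v ≠ 0 → 0 < (h x v v).re
  h_smooth : ∀ s t : ∀ x, L x, SmoothOn (E := E) L Set.univ s → SmoothOn (E := E) L Set.univ t →
    ContMDiff 𝓘(ℝ, E) 𝓘(ℝ, ℂ) ∞ fun x => h x (s x) (t x)
  cov : CovariantDerivative 𝓘(ℝ, E) ℂ L
  cov_I : ∀ s : ∀ x, L x, SmoothOn (E := E) L Set.univ s →
    ∀ (x : M) (v : TangentSpace 𝓘(ℝ, E) x),
      cov (fun y => Complex.I • s y) x v = Complex.I • cov s x v
  cov_smooth : ∀ s : ∀ x, L x, SmoothOn (E := E) L Set.univ s →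
    ∀ X : ∀ x : M, TangentSpace 𝓘(ℝ, E) x, SmoothField X →
      SmoothOn (E := E) L Set.univ fun x => cov s x (X x)
  cov_metric : ∀ s t : ∀ x, L x, SmoothOn (E := E) L Set.univ s →
    SmoothOn (E := E) L Set.univ t → ∀ (x : M) (v : TangentSpace 𝓘(ℝ, E) x),
      mvfderiv 𝓘(ℝ, E) (fun y => h y (s y) (t y)) x v =
        h x (cov s x v) (t x) + h x (s x) (cov t x v)
  curvature : ∀ s : ∀ x, L x, SmoothOn (E := E) L Set.univ s →
    ∀ X Y : ∀ x : M, TangentSpace 𝓘(ℝ, E) x, SmoothField X → SmoothField Y → ∀ x : M,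
      cov (fun y => cov s y (Y y)) x (X x) - cov (fun y => cov s y (X y)) x (Y x) -
        cov s x (VectorField.mlieBracket 𝓘(ℝ, E) X Y x) =
          (-(Complex.I * (K.form x (X x) (Y x) : ℂ))) • s x
  action : BundleAction (E := E) d G L
  unitary : ∀ (g : G) (x : M) (v w : L x),
    h (g • x) (action.map g x v) (action.map g x w) = h x v w
  infinitesimal : ∀ s : ∀ x, L x, SmoothOn (E := E) L Set.univ s →
    ∀ (ξ : LieAlg d G) (x : M) (v : L x),
      mvfderiv 𝓘(ℝ, EuclideanSpace ℝ (Fin d))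
        (fun g : G => h (g • x) (action.map g x v) (s (g • x))) 1 ξ =
      h x v (cov s x (infAction ξ x) - (Complex.I * (H.Φ x ξ : ℂ)) • s x)

/-- The structure of a `G`-equivariant square root of the canonical bundle on the smooth complex
line bundle `S`: a smooth nondegenerate fibrewise product `S ⊗ S → K`, and an action of `G` on `S`
which is compatible with the action `α ↦ (g⁻¹)^* α` of `G` on `K`. -/
structure HalfForm (n d : ℕ) (G : Type*) [TopologicalSpace G]
    [ChartedSpace (EuclideanSpace ℝ (Fin d)) G] [Group G] [MulAction G M]
    (S : M → Type*) [∀ x, AddCommGroup (S x)] [∀ x, Module ℂ (S x)]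
    [∀ x, TopologicalSpace (S x)] [TopologicalSpace (TotalSpace ℂ S)] [FiberBundle ℂ S] where
  mul : ∀ x : M, S x →ₗ[ℂ] S x →ₗ[ℂ] (TangentSpace 𝓘(ℂ, E) x [⋀^Fin n]→ₗ[ℂ] ℂ)
  mul_self_ne_zero : ∀ x v, v ≠ 0 → mul x v v ≠ 0
  mul_smooth : ∀ ν : ∀ x, S x, SmoothOn (E := E) S Set.univ ν → SmoothForm fun x => mul x (ν x) (ν x)
  action : BundleAction (E := E) d G S
  compatible : ∀ (g : G) (x : M) (v w : S x) (u : Fin n → TangentSpace 𝓘(ℂ, E) x),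
    mul (g • x) (action.map g x v) (action.map g x w) (fun i => pushComplex g x (u i)) =
      mul x v w u

variable {H} {m : ℕ}
  {L : M → Type*} [∀ x, AddCommGroup (L x)] [∀ x, Module ℂ (L x)]
  [∀ x, TopologicalSpace (L x)] [∀ x, IsTopologicalAddGroup (L x)] [∀ x, ContinuousSMul ℝ (L x)]
  [TopologicalSpace (TotalSpace ℂ L)] [FiberBundle ℂ L]
  {S : M → Type*} [∀ x, AddCommGroup (S x)] [∀ x, Module ℂ (S x)]
  [∀ x, TopologicalSpace (S x)] [TopologicalSpace (TotalSpace ℂ S)] [FiberBundle ℂ S]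
  (P : Prequantum H L) (Q : HalfForm (E := E) (d + m) d G S) (k : ℕ)

/-- A section of `L^{⊗ k} ⊗ S` is holomorphic if locally it is of the form `f s^{⊗ k} ⊗ ν` with
`f` a holomorphic function, `s` a nowhere vanishing smooth section of `L` which is covariantly
constant in the `(0,1)`-directions (`∇_{v + iJv} s = 0`), and `ν` a nowhere vanishing smooth section
of `S` whose square is a holomorphic `(n,0)`-form. -/
def IsHolomorphic (r : ∀ x : M, (⨂[ℂ]^k (L x)) ⊗[ℂ] S x) : Prop :=
  ∀ x₀ : M, ∃ U : Set M, IsOpen U ∧ x₀ ∈ U ∧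
    ∃ (f : M → ℂ) (s : ∀ x, L x) (ν : ∀ x, S x),
      MDifferentiableOn 𝓘(ℂ, E) 𝓘(ℂ, ℂ) f U ∧
      SmoothOn (E := E) L U s ∧
      (∀ x ∈ U, s x ≠ 0 ∧ ∀ v : TangentSpace 𝓘(ℝ, E) x,
        P.cov s x v + Complex.I • P.cov s x (complexJ x v) = 0) ∧
      SmoothOn (E := E) S U ν ∧ (∀ x ∈ U, ν x ≠ 0) ∧
      HolomorphicFormOn (fun x => Q.mul x (ν x) (ν x)) U ∧
      ∀ x ∈ U, r x = f x • ((PiTensorProduct.tprod ℂ fun _ : Fin k => s x) ⊗ₜ[ℂ] ν x)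

/-- The `G`-invariant sections of `L^{⊗ k} ⊗ S`. -/
def invariantSections : Submodule ℂ (∀ x : M, (⨂[ℂ]^k (L x)) ⊗[ℂ] S x) where
  carrier := {r | ∀ (g : G) (x : M),
    TensorProduct.map (PiTensorProduct.map fun _ : Fin k => P.action.map g x) (Q.action.map g x)
      (r x) = r (g • x)}
  add_mem' := by
    intro r r' hr hr' g x
    simp only [Pi.add_apply, _root_.map_add, hr g x, hr' g x]
  zero_mem' := by
    intro g x
    simp only [Pi.zero_apply, _root_.map_zero]
  smul_mem' := by
    intro c r hr g x
    simp only [Pi.smul_apply, _root_.map_smul, hr g x]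

/-- The pointwise magnitude `|r|²` on `L^{⊗ k} ⊗ S` at `x ∈ M`. -/
def mag (x : M) (t : (⨂[ℂ]^k (L x)) ⊗[ℂ] S x) : ℝ :=
  tensorMag (fun v => (P.h x v v).re)
    (fun ν => halfFormMag (d + m) (fun u w : TangentSpace 𝓘(ℝ, E) x => K.form x u w)
      (fun u => Q.mul x ν ν u)) k t

/-! ### The reduced bundles and the map `B_k` -/

/-- The fibre at `q` of the reduced prequantum bundle over `M // G`. -/
abbrev RedPrequantum (q : H.Reduced) := H.descend P.action.map q

/-- The fibre at `q` of the half-form bundle over `M // G`. -/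
abbrev RedHalfForm (H : HamiltonianAction d G K) (q : H.Reduced) := H.descend Q.action.map q

/-- The Hermitian form on the reduced prequantum bundle. -/
def redHermitian (q : H.Reduced) (v w : RedPrequantum P q) : ℂ :=
  P.h (HamiltonianAction.Orbit.rep q).pt (v.1 (HamiltonianAction.Orbit.rep q))
    (w.1 (HamiltonianAction.Orbit.rep q))

/-- The square `ν²` of a half-form on the quotient, an `(n-d,0)`-form on `M // G`: the descent of
the square of `ν`, regarded as a half-form on `M` along the orbit. -/
def redSquare (Ξ : Fin d → LieAlg d G) (q : H.Reduced) (ν : RedHalfForm Q H q) :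
    H.tangent q [⋀^Fin m]→ₗ[ℂ] ℂ :=
  H.descendForm Ξ (HamiltonianAction.Orbit.rep q)
    (Q.mul _ (ν.1 (HamiltonianAction.Orbit.rep q)) (ν.1 (HamiltonianAction.Orbit.rep q)))

/-- The pointwise magnitude on the reduced bundle at `q ∈ M // G`, where half-forms on `M // G` have
the magnitude given by their squares and the Liouville form of the reduced symplectic form. -/
def redMag (Ξ : Fin d → LieAlg d G) (q : H.Reduced)
    (t : (⨂[ℂ]^k (RedPrequantum P q)) ⊗[ℂ] RedHalfForm Q H q) : ℝ :=
  tensorMag (fun v => (redHermitian P q v v).re)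
    (fun ν => halfFormMag m (H.reducedForm q) (fun Y => redSquare Q Ξ q ν Y)) k t

/-- The map `B_k` from `G`-invariant sections of `L^{⊗ k} ⊗ S` over `M` to sections of the
corresponding bundle over `M // G`: the section `r` is restricted to `Φ⁻¹(0)` and descends to the
quotient, so `B_k (s^{⊗ k} ⊗ ν) = (A s)^{⊗ k} ⊗ B ν`, where `A s` and `B ν` are the families
`x ↦ s x` and `x ↦ ν x`, and `(B ν)²` is the descent of the form `ν²`. -/
def Bk : invariantSections P Q k →ₗ[ℂ]
    (∀ q : H.Reduced, (⨂[ℂ]^k (RedPrequantum P q)) ⊗[ℂ] RedHalfForm Q H q) :=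
  LinearMap.pi fun q =>
    (TensorProduct.congr
      (PiTensorProduct.congr fun _ : Fin k =>
        H.evalEquiv P.action (HamiltonianAction.Orbit.rep q))
      (H.evalEquiv Q.action (HamiltonianAction.Orbit.rep q))).symm.toLinearMap.comp
      ((LinearMap.proj (HamiltonianAction.Orbit.rep q).pt).comp (Submodule.subtype _))

end Bundles

end Kahler

end GeomQuant

end

/-! The identity is linear algebra at one point of `Φ⁻¹(0)`, together with a homogeneity argument on
`G`. Write `X_i` for the value at `x` of the field of `ξ_i`, and use the Hermitian inner product
with real part the metric `B` and imaginary part `ω`.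

Since `Φ` vanishes along the orbit, the orbit is isotropic, so the Hermitian Gram matrix of the
`X_i` is the real matrix `B(X_i, X_j)`. Regularity of `0` makes the `X_i` independent over `ℝ`, and
isotropy upgrades this to independence over `ℂ`. By the moment map equation, `T Φ⁻¹(0) ∩ J T Φ⁻¹(0)`
is the Hermitian complement of their complex span; it models the tangent space of the quotient.

In complex dimension `n`, a half-form with square `α` has magnitude `2^{n/2} |α(e)|` for any unitary
basis `e`: each coordinate contributes `|dz ∧ dz̄| = 2 |dx ∧ dy|` (`halfFormMag_eq`). Contracting
with the `X_i` and evaluating on a unitary basis of the complement multiplies `|α(e)|` by the square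
root of the Gram determinant, while the power of two drops from `2^{(d+m)/2}` to `2^{m/2}`. This is
`halfFormMag_contract`, the source of `2^{-d/2}`.

The root of the Gram determinant is the orbit volume (`orbitVolume_eq`): the orbit map pulls `B`
back to a left invariant metric on `G`, whose density relative to the normalized one is constant.
Finally, the reduced objects are defined through a chosen representative of the orbit; unitarity,
invariance of `ω` and `J`, and `Ad`-invariance carry the computation to any other point
(`redMag_Bk`). -/

namespace GeomQuant

noncomputable section

/-! ### Top-degree forms as determinants, and the half-form magnitude in a unitary basis -/

section TopForms

lemma det_eq_sum_prod_row {ι R : Type*} [Fintype ι] [DecidableEq ι] [CommRing R]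
    (A : Matrix ι ι R) :
    A.det = ∑ σ : Equiv.Perm ι, ((Equiv.Perm.sign σ : ℤ) : R) * ∏ i, A i (σ i) := by
  rw [← Matrix.det_transpose, Matrix.det_apply']
  rfl

/-- Laplace expansion along complementary blocks of rows, summed over all permutations. -/
lemma sum_sign_mul_det_mul_det {R : Type*} [CommRing R] {n : ℕ}
    (A B : Matrix (Fin n) (Fin n ⊕ Fin n) R) :
    ∑ σ : Equiv.Perm (Fin n ⊕ Fin n), ((Equiv.Perm.sign σ : ℤ) : R) *
      ((A.submatrix id (fun i => σ (Sum.inl i))).det *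
        (B.submatrix id (fun i => σ (Sum.inr i))).det) =
      ((n.factorial : R) * (n.factorial : R)) * (Matrix.fromRows A B).det := by
  -- Expanding both minors gives a sum over pairs of block permutations, whose signs are absorbed
  -- into that of the composite with `σ`.
  have h1 : ∀ σ : Equiv.Perm (Fin n ⊕ Fin n), ((Equiv.Perm.sign σ : ℤ) : R) *
      ((A.submatrix id (fun i => σ (Sum.inl i))).det *
        (B.submatrix id (fun i => σ (Sum.inr i))).det) =
      ∑ τ : Equiv.Perm (Fin n) × Equiv.Perm (Fin n),
        ((Equiv.Perm.sign (σ * Equiv.Perm.sumCongr τ.1 τ.2) : ℤ) : R) *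
          ∏ a, Matrix.fromRows A B a ((σ * Equiv.Perm.sumCongr τ.1 τ.2) a) := by
    intro σ
    rw [det_eq_sum_prod_row, det_eq_sum_prod_row, Finset.sum_mul_sum, ← Finset.sum_product',
      Finset.mul_sum]
    refine Finset.sum_congr rfl fun τ _ => ?_
    simp only [Matrix.submatrix_apply, id_eq, Equiv.Perm.sign_mul, Equiv.Perm.sign_sumCongr,
      Fintype.prod_sum_type, Matrix.fromRows_apply_inl, Matrix.fromRows_apply_inr,
      Equiv.Perm.coe_mul, Function.comp_apply, Equiv.sumCongr_apply, Sum.map_inl, Sum.map_inr,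
      Units.val_mul, Int.cast_mul]
    ring
  -- Right translation by a block permutation is a bijection, so each of the `n!²` pairs contributes
  -- the full determinant.
  have h2 : ∀ τ : Equiv.Perm (Fin n) × Equiv.Perm (Fin n),
      ∑ σ : Equiv.Perm (Fin n ⊕ Fin n),
        ((Equiv.Perm.sign (σ * Equiv.Perm.sumCongr τ.1 τ.2) : ℤ) : R) *
          ∏ a, Matrix.fromRows A B a ((σ * Equiv.Perm.sumCongr τ.1 τ.2) a) =
        (Matrix.fromRows A B).det := by
    intro τ
    rw [det_eq_sum_prod_row]
    exact Equiv.sum_comp (Equiv.mulRight (Equiv.Perm.sumCongr τ.1 τ.2))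
      (fun σ => ((Equiv.Perm.sign σ : ℤ) : R) * ∏ a, Matrix.fromRows A B a (σ a))
  rw [Finset.sum_congr rfl fun σ _ => h1 σ, Finset.sum_comm, Finset.sum_congr rfl fun τ _ => h2 τ]
  simp [Fintype.card_prod, Fintype.card_perm]

/-- Antisymmetrized products of the values of `p ∧ q` are, up to powers of two, those of
`p ⊗ q`. -/
lemma sum_sign_mul_prod_sub {R : Type*} [CommRing R] {n : ℕ} {W : Type*} (T : W → W → R)
    (v : Fin n ⊕ Fin n → W) :
    ∑ σ : Equiv.Perm (Fin n ⊕ Fin n), ((Equiv.Perm.sign σ : ℤ) : R) *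
      ∏ i : Fin n, (T (v (σ (Sum.inl i))) (v (σ (Sum.inr i))) -
        T (v (σ (Sum.inr i))) (v (σ (Sum.inl i)))) =
    2 ^ n * ∑ σ : Equiv.Perm (Fin n ⊕ Fin n), ((Equiv.Perm.sign σ : ℤ) : R) *
      ∏ i : Fin n, T (v (σ (Sum.inl i))) (v (σ (Sum.inr i))) := by
  let A : Fin n → Equiv.Perm (Fin n ⊕ Fin n) → R := fun i σ =>
    T (v (σ (Sum.inl i))) (v (σ (Sum.inr i)))
  let A' : Fin n → Equiv.Perm (Fin n ⊕ Fin n) → R := fun i σ =>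
    T (v (σ (Sum.inr i))) (v (σ (Sum.inl i)))
  -- Antisymmetrize only the factors indexed by `s`; each index added to `s` costs one factor of
  -- two.
  have key : ∀ s : Finset (Fin n),
      ∑ σ : Equiv.Perm (Fin n ⊕ Fin n), ((Equiv.Perm.sign σ : ℤ) : R) *
        ((∏ i ∈ s, (A i σ - A' i σ)) * ∏ i ∈ sᶜ, A i σ) =
      2 ^ s.card * ∑ σ : Equiv.Perm (Fin n ⊕ Fin n), ((Equiv.Perm.sign σ : ℤ) : R) *
        ∏ i, A i σ := by
    intro s
    induction s using Finset.induction_on with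
    | empty => simp
    | insert j s hj ih =>
      have hc : sᶜ = insert j (insert j s)ᶜ := by
        ext i
        simp only [Finset.mem_compl, Finset.mem_insert]
        by_cases h : i = j
        · subst h; simp [hj]
        · simp [h]
      have hjc : j ∉ (insert j s)ᶜ := by simp
      have e1 : ∀ σ, ((Equiv.Perm.sign σ : ℤ) : R) *
          ((∏ i ∈ insert j s, (A i σ - A' i σ)) * ∏ i ∈ (insert j s)ᶜ, A i σ) =
          ((Equiv.Perm.sign σ : ℤ) : R) * ((∏ i ∈ s, (A i σ - A' i σ)) * ∏ i ∈ sᶜ, A i σ) -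
          ((Equiv.Perm.sign σ : ℤ) : R) *
            (A' j σ * ((∏ i ∈ s, (A i σ - A' i σ)) * ∏ i ∈ (insert j s)ᶜ, A i σ)) := by
        intro σ
        rw [Finset.prod_insert hj, hc, Finset.prod_insert hjc]
        ring
      -- Precomposing `σ` with the transposition of `inl j` and `inr j` turns `A' j` into `A j`,
      -- fixes all other factors and flips the sign.
      have e2 : ∑ σ : Equiv.Perm (Fin n ⊕ Fin n), ((Equiv.Perm.sign σ : ℤ) : R) *
            (A' j σ * ((∏ i ∈ s, (A i σ - A' i σ)) * ∏ i ∈ (insert j s)ᶜ, A i σ)) =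
          - ∑ σ : Equiv.Perm (Fin n ⊕ Fin n), ((Equiv.Perm.sign σ : ℤ) : R) *
            ((∏ i ∈ s, (A i σ - A' i σ)) * ∏ i ∈ sᶜ, A i σ) := by
        rw [← Equiv.sum_comp (Equiv.mulRight (Equiv.swap (Sum.inl j) (Sum.inr j) :
          Equiv.Perm (Fin n ⊕ Fin n))), ← Finset.sum_neg_distrib]
        refine Finset.sum_congr rfl fun σ _ => ?_
        have hne : ∀ i : Fin n, i ≠ j →
            (Equiv.swap (Sum.inl j) (Sum.inr j) : Equiv.Perm (Fin n ⊕ Fin n)) (Sum.inl i) =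
              Sum.inl i ∧
            (Equiv.swap (Sum.inl j) (Sum.inr j) : Equiv.Perm (Fin n ⊕ Fin n)) (Sum.inr i) =
              Sum.inr i := fun i hi =>
          ⟨Equiv.swap_apply_of_ne_of_ne (by simpa using hi) (by simp),
            Equiv.swap_apply_of_ne_of_ne (by simp) (by simpa using hi)⟩
        have hA : ∀ i, i ≠ j → A i (σ * Equiv.swap (Sum.inl j) (Sum.inr j)) = A i σ := by
          intro i hi
          simp only [A, Equiv.Perm.coe_mul, Function.comp_apply, (hne i hi).1, (hne i hi).2]
        have hA' : ∀ i, i ≠ j → A' i (σ * Equiv.swap (Sum.inl j) (Sum.inr j)) = A' i σ := by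
          intro i hi
          simp only [A', Equiv.Perm.coe_mul, Function.comp_apply, (hne i hi).1, (hne i hi).2]
        have hj' : A' j (σ * Equiv.swap (Sum.inl j) (Sum.inr j)) = A j σ := by
          simp only [A, A', Equiv.Perm.coe_mul, Function.comp_apply, Equiv.swap_apply_left,
            Equiv.swap_apply_right]
        have hs : ∀ i ∈ s, i ≠ j := fun i hi h => hj (h ▸ hi)
        simp only [Equiv.coe_mulRight]
        rw [hj', Finset.prod_congr rfl fun i hi => by rw [hA i (hs i hi), hA' i (hs i hi)],
          Finset.prod_congr rfl fun i hi => hA i (by rintro rfl; exact hjc hi), Equiv.Perm.sign_mul,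
          Equiv.Perm.sign_swap (by simp), hc, Finset.prod_insert hjc]
        simp only [mul_neg, mul_one, Units.val_neg, Int.cast_neg]
        ring
      rw [Finset.sum_congr rfl fun σ _ => e1 σ, Finset.sum_sub_distrib, e2, ih,
        Finset.card_insert_of_notMem hj]
      ring
  have := key Finset.univ
  simpa [A, A'] using this

/-- The Pfaffian-type sum of a sum of decomposable bilinear forms is a determinant. -/
lemma sum_sign_mul_prod_sum {R : Type*} [CommRing R] {n : ℕ}
    (P Q : Matrix (Fin n) (Fin n ⊕ Fin n) R) :
    ∑ σ : Equiv.Perm (Fin n ⊕ Fin n), ((Equiv.Perm.sign σ : ℤ) : R) *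
      ∏ i : Fin n, ∑ j, P j (σ (Sum.inl i)) * Q j (σ (Sum.inr i)) =
    n.factorial * (Matrix.fromRows P Q).det := by
  -- Here `f` records which summand is taken in each factor. Non-injective `f` give repeated rows
  -- and drop out.
  have h1 : ∀ f : Fin n → Fin n,
      ∑ σ : Equiv.Perm (Fin n ⊕ Fin n), ((Equiv.Perm.sign σ : ℤ) : R) *
        ∏ i : Fin n, (P (f i) (σ (Sum.inl i)) * Q (f i) (σ (Sum.inr i))) =
      ((Matrix.fromRows P Q).submatrix (Sum.map f f) id).det := by
    intro f
    rw [det_eq_sum_prod_row]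
    refine Finset.sum_congr rfl fun σ _ => ?_
    simp [Fintype.prod_sum_type, Finset.prod_mul_distrib]
  simp only [Finset.prod_univ_sum, Finset.mul_sum, Fintype.piFinset_univ]
  rw [Finset.sum_comm]
  rw [Finset.sum_congr rfl fun f _ => h1 f]
  have h2 : ∀ f : Fin n → Fin n, ¬ Function.Bijective f →
      ((Matrix.fromRows P Q).submatrix (Sum.map f f) id).det = 0 := by
    intro f hf
    have hi : ¬ Function.Injective f := fun h => hf (Finite.injective_iff_bijective.mp h)
    simp only [Function.Injective, not_forall] at hi
    obtain ⟨i, j, hij, hne⟩ := hi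
    exact Matrix.det_zero_of_row_eq (i := Sum.inl i) (j := Sum.inl j) (by simpa using hne)
      (by funext a; simp [hij])
  -- The permutation acts on both row blocks at once, so its sign enters squared.
  have h3 : ∀ τ : Equiv.Perm (Fin n),
      ((Matrix.fromRows P Q).submatrix (Sum.map τ τ) id).det = (Matrix.fromRows P Q).det := by
    intro τ
    have := Matrix.det_permute (Equiv.Perm.sumCongr τ τ) (Matrix.fromRows P Q)
    rw [Equiv.Perm.sign_sumCongr, Int.units_mul_self, Units.val_one, Int.cast_one, one_mul] at this
    exact this
  rw [← Finset.sum_filter_add_sum_filter_not Finset.univ Function.Bijective,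
    Finset.sum_eq_zero (s := Finset.filter (fun f => ¬ Function.Bijective f) _)
      (fun f hf => h2 f (Finset.mem_filter.mp hf).2), add_zero]
  have h4 : ∑ f with Function.Bijective f,
      ((Matrix.fromRows P Q).submatrix (Sum.map f f) id).det =
      ∑ τ : Equiv.Perm (Fin n), ((Matrix.fromRows P Q).submatrix (Sum.map τ τ) id).det := by
    refine Finset.sum_bij' (fun f hf => Equiv.ofBijective f (Finset.mem_filter.mp hf).2)
      (fun τ _ => τ) ?_ ?_ ?_ ?_ ?_
    · simp
    · intro τ _
      exact Finset.mem_filter.mpr ⟨Finset.mem_univ _, τ.bijective⟩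
    · intro f hf
      rfl
    · intro τ _
      ext; rfl
    · intro f hf
      rfl
  rw [h4, Finset.sum_congr rfl fun τ _ => h3 τ]
  simp [Fintype.card_perm]

variable {V : Type*} [AddCommGroup V] [Module ℂ V]

/-- The matrix of the real and imaginary parts of the coordinates of a family of vectors. -/
def reImMatrix {n : ℕ} (e : Module.Basis (Fin n) ℂ V) (v : Fin n ⊕ Fin n → V) :
    Matrix (Fin n ⊕ Fin n) (Fin n ⊕ Fin n) ℝ :=
  Matrix.fromRows (Matrix.of fun j b => (e.repr (v b) j).re)
    (Matrix.of fun j b => (e.repr (v b) j).im)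

lemma reImMatrix_basis {n : ℕ} (e : Module.Basis (Fin n) ℂ V) :
    (reImMatrix e (Sum.elim e fun i => Complex.I • e i)).det = 1 := by
  have : reImMatrix e (Sum.elim e fun i => Complex.I • e i) = 1 := by
    ext a b
    rcases a with a | a <;> rcases b with b | b <;>
      simp [reImMatrix, Matrix.one_apply, Finsupp.single_apply, eq_comm, apply_ite]
  rw [this, Matrix.det_one]

/-- Since `α` is `α e` times the coordinate determinant, Laplace expansion turns `α ∧ ᾱ` into `|α
e|²` times the determinant with rows `z` and `z̄`. The constant is `dz ∧ dz̄ = -2i dx ∧ dy`, once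
per coordinate. -/
lemma wedgeConj_eq {n : ℕ} (e : Module.Basis (Fin n) ℂ V) (α : V [⋀^Fin n]→ₗ[ℂ] ℂ)
    (v : Fin n ⊕ Fin n → V) :
    wedgeConj n α v = α e * conj (α e) * ((-2 * Complex.I) ^ n * (reImMatrix e v).det) := by
  have hα : ∀ u : Fin n → V, α u = α e * (e.toMatrix u).det := by
    intro u
    conv_lhs => rw [AlternatingMap.eq_smul_basis_det e α]
    simp [Module.Basis.det_apply]
  let Z : Matrix (Fin n) (Fin n ⊕ Fin n) ℂ := Matrix.of fun j b => e.repr (v b) j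
  let Z' : Matrix (Fin n) (Fin n ⊕ Fin n) ℂ := Matrix.of fun j b => conj (e.repr (v b) j)
  have hsum : wedgeConj n α v = α e * conj (α e) * (Matrix.fromRows Z Z').det := by
    have hn : ((n.factorial : ℂ) * (n.factorial : ℂ)) ≠ 0 := by
      have := n.factorial_ne_zero
      simp [this]
    rw [wedgeConj, div_eq_iff hn, mul_assoc, mul_comm (Matrix.det _), ← sum_sign_mul_det_mul_det,
      Finset.mul_sum]
    refine Finset.sum_congr rfl fun σ _ => ?_
    rw [hα fun i => v (σ (Sum.inl i)), hα fun i => v (σ (Sum.inr i)), map_mul]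
    have h1 : e.toMatrix (fun i => v (σ (Sum.inl i))) =
        Z.submatrix id (fun i => σ (Sum.inl i)) := rfl
    have h2 : conj (e.toMatrix (fun i => v (σ (Sum.inr i)))).det =
        (Z'.submatrix id (fun i => σ (Sum.inr i))).det := by
      rw [RingHom.map_det]
      rfl
    rw [h1, h2]
    ring
  -- The rows `x + iy` and `x - iy` come from `x` and `y` by a block matrix, whose Schur complement
  -- is `-2i` times the identity.
  have hN : Matrix.fromRows Z Z' =
      Matrix.fromBlocks 1 (Complex.I • 1) 1 (-(Complex.I • 1)) *
        (reImMatrix e v).map (Complex.ofRealHom : ℝ →+* ℂ) := by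
    have hmap : (reImMatrix e v).map (Complex.ofRealHom : ℝ →+* ℂ) =
      Matrix.fromRows (Matrix.of fun j b => ((e.repr (v b) j).re : ℂ))
        (Matrix.of fun j b => ((e.repr (v b) j).im : ℂ)) := by
      ext a b
      rcases a with a | a <;> rfl
    rw [hmap, Matrix.fromBlocks_mul_fromRows]
    ext a b
    rcases a with a | a
    · simp [Z, mul_comm Complex.I, Complex.re_add_im]
    · simp only [Matrix.fromRows_apply_inr, Matrix.of_apply, Z', Matrix.one_mul, Matrix.neg_mul,
        Matrix.smul_mul, Matrix.add_apply, Matrix.neg_apply, Matrix.smul_apply, smul_eq_mul]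
      apply Complex.ext <;> simp
  rw [hsum, hN, Matrix.det_mul, Matrix.det_fromBlocks_one₁₁, ← RingHom.mapMatrix_apply,
    ← RingHom.map_det]
  congr 2
  have : (-(Complex.I • (1 : Matrix (Fin n) (Fin n) ℂ)) - 1 * (Complex.I • 1)) =
      (-2 * Complex.I) • 1 := by
    rw [Matrix.one_mul, neg_mul, neg_smul, mul_smul, two_smul]
    abel
  rw [this, Matrix.det_smul, Matrix.det_one]
  simp

/-- The hypothesis is the Darboux form `ω = ∑ dx_j ∧ dy_j`. Antisymmetry of each factor yields `2^n`
and the assignment of summands to factors yields `n!`, which together cancel the denominator of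
`liouville`. -/
lemma liouville_eq {n : ℕ} (e : Module.Basis (Fin n) ℂ V) (w₂ : V → V → ℝ)
    (hw : ∀ u v, w₂ u v = ∑ j, ((e.repr u j).re * (e.repr v j).im -
      (e.repr v j).re * (e.repr u j).im))
    (v : Fin n ⊕ Fin n → V) : liouville n w₂ v = (reImMatrix e v).det := by
  have hn : (2 ^ n * (n.factorial : ℝ)) ≠ 0 := by
    have := n.factorial_ne_zero
    simp [this]
  have h1 := sum_sign_mul_prod_sub (R := ℝ)
    (fun u w : V => ∑ j, (e.repr u j).re * (e.repr w j).im) v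
  have h2 := sum_sign_mul_prod_sum (Matrix.of fun j b => (e.repr (v b) j).re)
    (Matrix.of fun j b => (e.repr (v b) j).im)
  rw [liouville, div_eq_iff hn]
  simp only [hw, Finset.sum_sub_distrib]
  rw [h1]
  simp only [Matrix.of_apply] at h2
  rw [h2, reImMatrix]
  ring

/-- The magnitude of a half-form in terms of a unitary basis. -/
lemma halfFormMag_eq {n : ℕ} (e : Module.Basis (Fin n) ℂ V) (w₂ : V → V → ℝ)
    (hw : ∀ u v, w₂ u v = ∑ j, ((e.repr u j).re * (e.repr v j).im -
      (e.repr v j).re * (e.repr u j).im))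
    (α : V [⋀^Fin n]→ₗ[ℂ] ℂ) : halfFormMag n w₂ α = √(2 ^ n) * ‖α e‖ := by
  have hset : {t : ℝ | 0 ≤ t ∧ ∀ v : Fin n ⊕ Fin n → V,
      ‖wedgeConj n α v‖ = t ^ 2 * |liouville n w₂ v|} = {√(2 ^ n) * ‖α e‖} := by
    have hsq : (√(2 ^ n) * ‖α e‖) ^ 2 = 2 ^ n * ‖α e‖ ^ 2 := by
      rw [mul_pow, Real.sq_sqrt (by positivity)]
    have hnorm : ∀ v : Fin n ⊕ Fin n → V,
        ‖wedgeConj n α v‖ = (√(2 ^ n) * ‖α e‖) ^ 2 * |liouville n w₂ v| := by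
      intro v
      rw [wedgeConj_eq e, liouville_eq e w₂ hw, hsq]
      simp only [norm_mul, norm_pow, norm_neg, Complex.norm_I, RCLike.norm_conj, Complex.norm_real,
        Real.norm_eq_abs, Complex.norm_ofNat]
      ring
    ext t
    simp only [Set.mem_ofPred_eq, Set.mem_singleton_iff]
    constructor
    · rintro ⟨ht, h⟩
      -- The Liouville form equals one on this family, which pins `t` down.
      have h1 := h (Sum.elim e fun i => Complex.I • e i)
      rw [hnorm, liouville_eq e w₂ hw, reImMatrix_basis, abs_one, mul_one, mul_one] at h1
      exact ((sq_eq_sq₀ (by positivity) ht).mp h1).symm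
    · rintro rfl
      exact ⟨by positivity, hnorm⟩
  rw [halfFormMag, hset, csInf_singleton]

end TopForms

/-! ### Hermitian linear algebra: contraction and restriction to the complement -/

section Unitary

/-- Parseval's identity; this supplies the Darboux hypothesis of `halfFormMag_eq` for orthonormal
bases. -/
lemma im_inner_eq_sum {V : Type*} [NormedAddCommGroup V] [InnerProductSpace ℂ V] {n : ℕ}
    (b : OrthonormalBasis (Fin n) ℂ V) (u v : V) :
    (inner ℂ u v).im = ∑ j, ((b.repr u j).re * (b.repr v j).im -
      (b.repr v j).re * (b.repr u j).im) := by
  rw [← b.sum_inner_mul_inner u v, Complex.im_sum]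
  refine Finset.sum_congr rfl fun j _ => ?_
  rw [← inner_conj_symm u (b j), ← b.repr_apply_apply, ← b.repr_apply_apply, Complex.mul_im,
    Complex.conj_re, Complex.conj_im]
  ring

/-- With `C` the coordinate matrix of `v`, the form scales by `det C`, and the Gram matrix is `Cᴴ
C`. -/
lemma norm_alternating_eq {V : Type*} [NormedAddCommGroup V] [InnerProductSpace ℂ V] {n : ℕ}
    (b : OrthonormalBasis (Fin n) ℂ V) (α : V [⋀^Fin n]→ₗ[ℂ] ℂ) (v : Fin n → V) :
    ‖α v‖ = √(Matrix.gram ℂ v).det.re * ‖α b‖ := by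
  have h1 : ‖α v‖ = ‖α b‖ * ‖(b.toBasis.toMatrix v).det‖ := by
    conv_lhs => rw [AlternatingMap.eq_smul_basis_det b.toBasis α]
    simp [Module.Basis.det_apply]
  have h2 : (Matrix.gram ℂ v).det = ((‖(b.toBasis.toMatrix v).det‖ ^ 2 : ℝ) : ℂ) := by
    rw [Matrix.gram_eq_conjTranspose_mul b v, Matrix.det_mul, Matrix.det_conjTranspose]
    rw [Complex.ofReal_pow, ← Complex.conj_mul']
    rfl
  rw [h1, h2, Complex.ofReal_re, Real.sqrt_sq (norm_nonneg _), mul_comm]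

lemma halfFormMag_inner {V : Type*} [NormedAddCommGroup V] [InnerProductSpace ℂ V] {n : ℕ}
    (b : OrthonormalBasis (Fin n) ℂ V) (α : V [⋀^Fin n]→ₗ[ℂ] ℂ) :
    halfFormMag n (fun u v : V => (inner ℂ u v).im) α = √(2 ^ n) * ‖α b‖ := by
  rw [halfFormMag_eq b.toBasis _ _ α]
  · simp
  · intro u v
    exact im_inner_eq_sum b u v

/-- Contraction with `d` independent vectors which span a totally real subspace, followed by the
restriction to the orthogonal complement. -/
lemma halfFormMag_contract_inner {V : Type*} [NormedAddCommGroup V] [InnerProductSpace ℂ V]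
    [FiniteDimensional ℂ V] {d m : ℕ} (hV : Module.finrank ℂ V = d + m)
    (X : Fin d → V) (hX : LinearIndependent ℂ X)
    {W : Type*} [AddCommGroup W] [Module ℂ W] (l : W →ₗ[ℂ] V) (hl : Function.Injective l)
    (hlX : LinearMap.range l = (Submodule.span ℂ (Set.range X))ᗮ)
    (α : V [⋀^Fin (d + m)]→ₗ[ℂ] ℂ) :
    halfFormMag m (fun Y Z : W => (inner ℂ (l Y) (l Z)).im)
        ((contract X α).compLinearMap l) =
      (2 : ℝ) ^ (-(d : ℝ) / 2) * √(Matrix.gram ℂ X).det.re *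
        halfFormMag (d + m) (fun u v : V => (inner ℂ u v).im) α := by
  have hdim : Module.finrank ℂ (LinearMap.range l) = m := by
    have h1 := Submodule.finrank_add_finrank_orthogonal (Submodule.span ℂ (Set.range X))
    rw [finrank_span_eq_card hX, Fintype.card_fin, hV, ← hlX] at h1
    omega
  let g : OrthonormalBasis (Fin m) ℂ (LinearMap.range l) :=
    (stdOrthonormalBasis ℂ (LinearMap.range l)).reindex (finCongr hdim)
  let b : OrthonormalBasis (Fin (d + m)) ℂ V :=
    (stdOrthonormalBasis ℂ V).reindex (finCongr hV)
  let e := LinearEquiv.ofInjective l hl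
  let f : Module.Basis (Fin m) ℂ W := g.toBasis.map e.symm
  have hlf : ∀ i, l (f i) = g i := by
    intro i
    have : e (f i) = g i := by simp [f]
    rw [← this]
    rfl
  -- The Gram matrix is block diagonal, with the identity as the block of the orthonormal basis of
  -- the complement.
  have hgram : (Matrix.gram ℂ (Fin.append X (l ∘ f))).det = (Matrix.gram ℂ X).det := by
    rw [← Matrix.det_submatrix_equiv_self finSumFinEquiv]
    have hb : (Matrix.gram ℂ (Fin.append X (l ∘ f))).submatrix finSumFinEquiv finSumFinEquiv =
        Matrix.fromBlocks (Matrix.gram ℂ X) 0 0 1 := by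
      have horth : ∀ i j, inner ℂ (X i) ((g j : V)) = 0 := by
        intro i j
        have hg : (g j : V) ∈ (Submodule.span ℂ (Set.range X))ᗮ := hlX ▸ (g j).2
        exact Submodule.inner_right_of_mem_orthogonal (Submodule.subset_span (Set.mem_range_self i)) hg
      have hon := g.orthonormal
      rw [orthonormal_iff_ite] at hon
      ext a c
      rcases a with a | a <;> rcases c with c | c
      · simp [Matrix.gram_apply]
      · simp [Matrix.gram_apply, hlf, horth]
      · simp [Matrix.gram_apply, hlf, inner_eq_zero_symm.mp (horth c a)]
      · have := hon a c
        rw [Submodule.coe_inner] at this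
        simp [Matrix.gram_apply, hlf, this, Matrix.one_apply]
    rw [hb, Matrix.det_fromBlocks_zero₁₂, Matrix.det_one, mul_one]
  have hmag := halfFormMag_eq f (fun Y Z : W => (inner ℂ (l Y) (l Z)).im) (by
    intro u v
    exact im_inner_eq_sum g (e u) (e v)) ((contract X α).compLinearMap l)
  have hα : ((contract X α).compLinearMap l) f = α (Fin.append X (l ∘ f)) := rfl
  rw [hmag, halfFormMag_inner b, hα, norm_alternating_eq b, hgram]
  -- The constant `2^{-d/2}` compares the normalizations of the magnitude in dimensions `m` and `d +
  -- m`.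
  have h2 : √((2 : ℝ) ^ m) = (2 : ℝ) ^ (-(d : ℝ) / 2) * √(2 ^ (d + m)) := by
    rw [Real.sqrt_eq_rpow, Real.sqrt_eq_rpow, ← Real.rpow_natCast, ← Real.rpow_natCast,
      ← Real.rpow_mul (by norm_num), ← Real.rpow_mul (by norm_num),
      ← Real.rpow_add (by norm_num)]
    congr 1
    push_cast
    ring
  rw [h2]
  ring

variable {V : Type*} [AddCommGroup V] [Module ℂ V]

/-- The Hermitian inner product of a compatible positive symplectic form. -/
@[reducible] def kahlerCore (w : V →ₗ[ℝ] V →ₗ[ℝ] ℝ) (halt : ∀ v, w v v = 0)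
    (hJ : ∀ u v, w (Complex.I • u) (Complex.I • v) = w u v)
    (hpos : ∀ v, v ≠ 0 → 0 < w v (Complex.I • v)) : InnerProductSpace.Core ℂ V :=
  have hskew : ∀ u v, w u v = - w v u := by
    intro u v
    have h := halt (u + v)
    simp only [map_add, LinearMap.add_apply, halt] at h
    linarith
  have hJ1 : ∀ u v, w (Complex.I • u) v = - w u (Complex.I • v) := by
    intro u v
    rw [← hJ u (Complex.I • v), smul_smul, Complex.I_mul_I, neg_one_smul, map_neg, neg_neg]
  have hnn : ∀ v, 0 ≤ w v (Complex.I • v) := by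
    intro v
    by_cases h : v = 0
    · simp [h]
    · exact (hpos v h).le
  { inner := fun u v => ⟨w u (Complex.I • v), w u v⟩
    conj_inner_symm := by
      intro u v
      apply Complex.ext
      · rw [Complex.conj_re]
        change w v (Complex.I • u) = w u (Complex.I • v)
        rw [hskew v, hJ1, neg_neg]
      · rw [Complex.conj_im]
        exact (hskew u v).symm
    re_inner_nonneg := hnn
    definite := by
      intro v h
      by_contra hv
      exact (hpos v hv).ne' (congrArg Complex.re h)
    add_left := by
      intro u v z
      apply Complex.ext <;> simp
    smul_left := by
      intro u v c
      have hc : c • u = c.re • u + c.im • (Complex.I • u) := by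
        conv_lhs => rw [← Complex.re_add_im c, add_smul, mul_smul]
        rfl
      apply Complex.ext
      · rw [Complex.mul_re, Complex.conj_re, Complex.conj_im]
        change w (c • u) (Complex.I • v) = c.re * w u (Complex.I • v) - -c.im * w u v
        rw [hc, map_add w, LinearMap.add_apply, map_smul w, map_smul w, LinearMap.smul_apply,
          LinearMap.smul_apply, hJ, smul_eq_mul, smul_eq_mul]
        ring
      · rw [Complex.mul_im, Complex.conj_re, Complex.conj_im]
        change w (c • u) v = c.re * w u v + -c.im * w u (Complex.I • v)
        rw [hc, map_add w, LinearMap.add_apply, map_smul w, map_smul w, LinearMap.smul_apply,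
          LinearMap.smul_apply, hJ1, smul_eq_mul, smul_eq_mul]
        ring }

/-- The Gram determinant of the contracted vectors relates the half-form magnitude of a top-degree
form to that of its reduction to the Hermitian complement. -/
theorem halfFormMag_contract [FiniteDimensional ℂ V] {d m : ℕ}
    (hV : Module.finrank ℂ V = d + m) (w : V →ₗ[ℝ] V →ₗ[ℝ] ℝ) (halt : ∀ v, w v v = 0)
    (hJ : ∀ u v, w (Complex.I • u) (Complex.I • v) = w u v)
    (hpos : ∀ v, v ≠ 0 → 0 < w v (Complex.I • v))
    (X : Fin d → V) (hX : LinearIndependent ℝ X) (hiso : ∀ i j, w (X i) (X j) = 0)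
    {W : Type*} [AddCommGroup W] [Module ℂ W] (l : W →ₗ[ℂ] V) (hl : Function.Injective l)
    (hlX : ∀ v, v ∈ LinearMap.range l ↔ ∀ i, w (X i) v = 0 ∧ w (X i) (Complex.I • v) = 0)
    (α : V [⋀^Fin (d + m)]→ₗ[ℂ] ℂ) :
    halfFormMag m (fun Y Z : W => w (l Y) (l Z)) ((contract X α).compLinearMap l) =
      (2 : ℝ) ^ (-(d : ℝ) / 2) *
        √(Matrix.of fun i j => w (X i) (Complex.I • X j)).det *
        halfFormMag (d + m) (fun u v : V => w u v) α := by
  let C := kahlerCore w halt hJ hpos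
  let : NormedAddCommGroup V := C.toNormedAddCommGroup
  let : InnerProductSpace ℂ V := InnerProductSpace.ofCore C.toCore
  have hinner : ∀ u v : V, inner ℂ u v = ⟨w u (Complex.I • v), w u v⟩ := fun u v => rfl
  have hgram : Matrix.gram ℂ X =
      (Matrix.of fun i j => w (X i) (Complex.I • X j)).map (Complex.ofRealHom : ℝ →+* ℂ) := by
    ext i j
    rw [Matrix.gram_apply, hinner, hiso]
    rfl
  have hdet : (Matrix.gram ℂ X).det.re =
      (Matrix.of fun i j => w (X i) (Complex.I • X j)).det := by
    rw [hgram, ← RingHom.mapMatrix_apply, ← RingHom.map_det]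
    rfl
  -- Write a complex relation as `a + I b = 0` with `a`, `b` in the real span. Isotropy gives `w b
  -- (I b) = -w b a = 0`, so positivity forces `b = 0`, hence `a = 0`.
  have hXc : LinearIndependent ℂ X := by
    rw [Fintype.linearIndependent_iff]
    intro c hc
    have hsplit : (∑ i, (c i).re • X i) + Complex.I • (∑ i, (c i).im • X i) = 0 := by
      rw [← hc, Finset.smul_sum, ← Finset.sum_add_distrib]
      refine Finset.sum_congr rfl fun i _ => ?_
      conv_rhs => rw [← Complex.re_add_im (c i), add_smul, mul_comm, mul_smul]
      rfl
    have hw : w (∑ i, (c i).im • X i) (∑ i, (c i).re • X i) = 0 := by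
      simp [hiso]
    have him : ∑ i, (c i).im • X i = 0 := by
      by_contra hne
      have h1 := hpos _ hne
      rw [eq_neg_of_add_eq_zero_right hsplit, map_neg, hw] at h1
      simp at h1
    have hre : ∑ i, (c i).re • X i = 0 := by simpa [him] using hsplit
    intro i
    exact Complex.ext (Fintype.linearIndependent_iff.mp hX _ hre i)
      (Fintype.linearIndependent_iff.mp hX _ him i)
  have hrange : LinearMap.range l = (Submodule.span ℂ (Set.range X))ᗮ := by
    ext v
    rw [hlX, Submodule.mem_orthogonal]
    constructor
    · intro h u hu
      induction hu using Submodule.span_induction with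
      | mem u hu =>
        obtain ⟨i, rfl⟩ := hu
        rw [hinner, (h i).1, (h i).2]
        rfl
      | zero => exact inner_zero_left v
      | add a b _ _ ha hb => rw [inner_add_left, ha, hb, add_zero]
      | smul c a _ ha => rw [inner_smul_left, ha, mul_zero]
    · intro h i
      have h1 := h (X i) (Submodule.subset_span (Set.mem_range_self i))
      rw [hinner] at h1
      exact ⟨congrArg Complex.im h1, congrArg Complex.re h1⟩
  have := halfFormMag_contract_inner hV X hXc l hl hrange α
  rw [hdet] at this
  exact this

end Unitary

/-! ### Derivatives of the action and of the orbit map -/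

section Calculus

lemma hasMFDerivAt_restrictScalars {E F : Type*} [NormedAddCommGroup E] [NormedSpace ℂ E]
    [NormedAddCommGroup F] [NormedSpace ℂ F] {M N : Type*} [TopologicalSpace M] [ChartedSpace E M]
    [TopologicalSpace N] [ChartedSpace F N] {f : M → N} {x : M} {f' : E →L[ℂ] F}
    (h : HasMFDerivAt 𝓘(ℂ, E) 𝓘(ℂ, F) f x f') :
    HasMFDerivAt 𝓘(ℝ, E) 𝓘(ℝ, F) f x (f'.restrictScalars ℝ : E →L[ℝ] F) :=
  ⟨h.1, HasFDerivWithinAt.restrictScalars ℝ h.2⟩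

variable {E : Type*} [NormedAddCommGroup E] [NormedSpace ℂ E]
variable {M : Type*} [TopologicalSpace M] [ChartedSpace E M]

section Group

variable {G : Type*} [Group G] [MulAction G M]

/-- Restriction of scalars on the derivative. It makes the real derivative of `g` commute with `J`.
-/
lemma pushReal_eq_pushComplex {g : G} {x : M}
    (h : MDifferentiableAt 𝓘(ℂ, E) 𝓘(ℂ, E) (fun y : M => g • y) x) (v : E) :
    (pushReal g x v : E) = (pushComplex g x v : E) := by
  have := (hasMFDerivAt_restrictScalars h.hasMFDerivAt).mfderiv
  exact congrArg (fun T : E →L[ℝ] E => T v) this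

lemma pushComplex_one (x : M) (v : E) : (pushComplex (1 : G) x v : E) = v := by
  have h : (fun y : M => (1 : G) • y) = id := funext fun y => one_smul G y
  have h2 : (mfderiv 𝓘(ℂ, E) 𝓘(ℂ, E) (fun y : M => (1 : G) • y) x : E →L[ℂ] E) =
      (mfderiv 𝓘(ℂ, E) 𝓘(ℂ, E) (id : M → M) x : E →L[ℂ] E) := by
    rw [h]
  exact (congrArg (fun T : E →L[ℂ] E => T v) h2).trans
    (congrArg (fun T : E →L[ℂ] E => T v) (mfderiv_id (I := 𝓘(ℂ, E)) (x := x)))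

lemma pushComplex_mul {g h : G} {x : M}
    (hg : MDifferentiable 𝓘(ℂ, E) 𝓘(ℂ, E) (fun y : M => g • y))
    (hh : MDifferentiable 𝓘(ℂ, E) 𝓘(ℂ, E) (fun y : M => h • y)) (v : E) :
    (pushComplex (g * h) x v : E) = (pushComplex g (h • x) (pushComplex h x v) : E) := by
  have e : (fun y : M => (g * h) • y) = (fun y : M => g • y) ∘ (fun y : M => h • y) :=
    funext fun y => mul_smul g h y
  have h2 : (mfderiv 𝓘(ℂ, E) 𝓘(ℂ, E) (fun y : M => (g * h) • y) x : E →L[ℂ] E) =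
      (mfderiv 𝓘(ℂ, E) 𝓘(ℂ, E) ((fun y : M => g • y) ∘ (fun y : M => h • y)) x : E →L[ℂ] E) := by
    rw [e]
  exact (congrArg (fun T : E →L[ℂ] E => T v) h2).trans
    (mfderiv_comp_apply x (hg (h • x)) (hh x) v)

end Group

variable {d : ℕ} {G : Type*} [TopologicalSpace G] [ChartedSpace (EuclideanSpace ℝ (Fin d)) G]
  [Group G] [MulAction G M]

/-- The infinitesimal action at a point, as a linear map. -/
def infActionₗ (x : M) : LieAlg d G →ₗ[ℝ] E :=
  (mfderiv 𝓘(ℝ, EuclideanSpace ℝ (Fin d)) 𝓘(ℝ, E) (fun g : G => g • x) 1 :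
    EuclideanSpace ℝ (Fin d) →L[ℝ] E).toLinearMap

section Smooth

lemma mdifferentiable_const_smul (E : Type*) [NormedAddCommGroup E] [NormedSpace ℂ E]
    {M : Type*} [TopologicalSpace M] [ChartedSpace E M] (d : ℕ) {G : Type*} [TopologicalSpace G]
    [ChartedSpace (EuclideanSpace ℝ (Fin d)) G] [Group G] [MulAction G M]
    [ContMDiffSMul 𝓘(ℝ, EuclideanSpace ℝ (Fin d)) 𝓘(ℝ, E) ∞ G M] (g : G) :
    MDifferentiable 𝓘(ℝ, E) 𝓘(ℝ, E) (fun y : M => g • y) :=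
  (ContMDiffSMul.contMDiff_const_smul (I := 𝓘(ℝ, EuclideanSpace ℝ (Fin d))) (n := ∞)
    g).mdifferentiable (by simp)

variable [ContMDiffSMul 𝓘(ℝ, EuclideanSpace ℝ (Fin d)) 𝓘(ℝ, E) ∞ G M]

variable (d E) in
lemma mdifferentiable_smul_const (x : M) :
    MDifferentiable 𝓘(ℝ, EuclideanSpace ℝ (Fin d)) 𝓘(ℝ, E) (fun g : G => g • x) :=
  (ContMDiff.smul (I := 𝓘(ℝ, EuclideanSpace ℝ (Fin d))) (I' := 𝓘(ℝ, E)) (n := ∞)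
    (contMDiff_id : ContMDiff 𝓘(ℝ, EuclideanSpace ℝ (Fin d)) 𝓘(ℝ, EuclideanSpace ℝ (Fin d)) ∞
      (id : G → G))
    (contMDiff_const (c := x))).mdifferentiable (by simp)

variable [LieGroup 𝓘(ℝ, EuclideanSpace ℝ (Fin d)) ∞ G]

variable (d) in
lemma mdifferentiable_mul_left (g : G) :
    MDifferentiable 𝓘(ℝ, EuclideanSpace ℝ (Fin d)) 𝓘(ℝ, EuclideanSpace ℝ (Fin d))
      (fun h : G => g * h) :=
  (contMDiff_mul_left (I := 𝓘(ℝ, EuclideanSpace ℝ (Fin d))) (n := ∞)).mdifferentiable (by simp)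

variable (d) in
lemma mdifferentiable_conj (g : G) :
    MDifferentiable 𝓘(ℝ, EuclideanSpace ℝ (Fin d)) 𝓘(ℝ, EuclideanSpace ℝ (Fin d))
      (fun h : G => g * h * g⁻¹) :=
  ((contMDiff_mul_right (I := 𝓘(ℝ, EuclideanSpace ℝ (Fin d))) (n := ∞) (a := g⁻¹)).comp
    (contMDiff_mul_left (I := 𝓘(ℝ, EuclideanSpace ℝ (Fin d))) (n := ∞)
      (a := g))).mdifferentiable (by simp)

/-- The infinitesimal action is equivariant. -/
lemma infAction_smul (g : G) (x : M) (ξ : LieAlg d G) :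
    (infAction ξ (g • x) : E) = (pushReal g x (infAction (Ad d g⁻¹ ξ) x) : E) := by
  -- Use `h g x = g (g⁻¹ h g) x` and the chain rule at `h = 1`, a fixed point of conjugation.
  have e : (fun h : G => h • g • x) =
      (fun y : M => g • y) ∘ ((fun h : G => h • x) ∘ (fun h : G => g⁻¹ * h * g⁻¹⁻¹)) := by
    funext h
    simp [mul_smul]
  have h1 : g⁻¹ * (1 : G) * g⁻¹⁻¹ = 1 := by simp
  have hc := mdifferentiable_conj d g⁻¹ (1 : G)
  have ho := mdifferentiable_smul_const E d x (1 : G)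
  have h2 : (mfderiv 𝓘(ℝ, EuclideanSpace ℝ (Fin d)) 𝓘(ℝ, E) (fun h : G => h • g • x) 1 :
        EuclideanSpace ℝ (Fin d) →L[ℝ] E) =
      (mfderiv 𝓘(ℝ, EuclideanSpace ℝ (Fin d)) 𝓘(ℝ, E)
        ((fun y : M => g • y) ∘ ((fun h : G => h • x) ∘ (fun h : G => g⁻¹ * h * g⁻¹⁻¹))) 1 :
        EuclideanSpace ℝ (Fin d) →L[ℝ] E) := by
    rw [e]
  refine (congrArg (fun T : EuclideanSpace ℝ (Fin d) →L[ℝ] E => T ξ) h2).trans ?_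
  have h3 := mfderiv_comp_apply_of_eq (x := (1 : G)) (y := x)
    (mdifferentiable_const_smul E d g x) (ho.comp_of_eq _ hc h1)
    ((congrArg (· • x) h1).trans (one_smul G x)) ξ
  refine h3.trans ?_
  have h4 := mfderiv_comp_apply_of_eq (x := (1 : G)) (y := (1 : G)) ho hc h1 ξ
  exact congrArg (fun w : E => (mfderiv 𝓘(ℝ, E) 𝓘(ℝ, E) (fun y : M => g • y) x :
    E →L[ℝ] E) w) h4

/-- The derivative of the orbit map in terms of left translation to the identity. -/
lemma mfderiv_smul_const (g : G) (x : M) (v : EuclideanSpace ℝ (Fin d)) :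
    (mfderiv 𝓘(ℝ, EuclideanSpace ℝ (Fin d)) 𝓘(ℝ, E) (fun h : G => h • x) g v : E) =
      (pushReal g x (infAction (M := M) (G := G) (mfderiv 𝓘(ℝ, EuclideanSpace ℝ (Fin d))
        𝓘(ℝ, EuclideanSpace ℝ (Fin d)) (fun h : G => g⁻¹ * h) g v : EuclideanSpace ℝ (Fin d)) x) :
        E) := by
  have e : (fun h : G => h • x) =
      (fun y : M => g • y) ∘ ((fun h : G => h • x) ∘ (fun h : G => g⁻¹ * h)) := by
    funext h
    simp [mul_smul]
  have h1 : g⁻¹ * g = 1 := by simp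
  have hc := mdifferentiable_mul_left d g⁻¹ g
  have ho := mdifferentiable_smul_const E d x (1 : G)
  have h2 : (mfderiv 𝓘(ℝ, EuclideanSpace ℝ (Fin d)) 𝓘(ℝ, E) (fun h : G => h • x) g :
        EuclideanSpace ℝ (Fin d) →L[ℝ] E) =
      (mfderiv 𝓘(ℝ, EuclideanSpace ℝ (Fin d)) 𝓘(ℝ, E)
        ((fun y : M => g • y) ∘ ((fun h : G => h • x) ∘ (fun h : G => g⁻¹ * h))) g :
        EuclideanSpace ℝ (Fin d) →L[ℝ] E) := by
    rw [← e]
  refine (congrArg (fun T : EuclideanSpace ℝ (Fin d) →L[ℝ] E => T v) h2).trans ?_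
  have h3 := mfderiv_comp_apply_of_eq (x := g) (y := x)
    (mdifferentiable_const_smul E d g x) (ho.comp_of_eq _ hc h1)
    ((congrArg (· • x) h1).trans (one_smul G x)) v
  refine h3.trans ?_
  have h4 := mfderiv_comp_apply_of_eq (x := g) (y := (1 : G)) ho hc h1 v
  exact congrArg (fun w : E => (mfderiv 𝓘(ℝ, E) 𝓘(ℝ, E) (fun y : M => g • y) x :
    E →L[ℝ] E) w) h4

end Smooth

end Calculus

/-! ### The orbit volume as a Gram determinant -/

section OrbitVolume

/-- If `T` is the coordinate matrix of `D`, every bilinear form has Gram matrix `Tᵀ · Gram(Ξ) · T`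
on `D`. For `b` the middle factor is the identity, so its determinant on `D` is `(det T)²`. -/
lemma det_bilin_eq {W : Type*} [AddCommGroup W] [Module ℝ W] {d : ℕ}
    (b b' : W →ₗ[ℝ] W →ₗ[ℝ] ℝ) (Ξ : Module.Basis (Fin d) ℝ W)
    (hΞ : ∀ i j, b (Ξ i) (Ξ j) = if i = j then 1 else 0) (D : Fin d → W) :
    (Matrix.of fun i j => b' (D i) (D j)).det =
      (Matrix.of fun i j => b (D i) (D j)).det * (Matrix.of fun i j => b' (Ξ i) (Ξ j)).det := by
  have key : ∀ c : W →ₗ[ℝ] W →ₗ[ℝ] ℝ, (Matrix.of fun i j => c (D i) (D j)) =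
      (Ξ.toMatrix D).transpose * (Matrix.of fun i j => c (Ξ i) (Ξ j)) * Ξ.toMatrix D := by
    intro c
    ext i j
    simp only [Matrix.mul_apply, Matrix.transpose_apply, Matrix.of_apply, Finset.sum_mul]
    conv_lhs => rw [← Ξ.sum_toMatrix_smul_self D i, ← Ξ.sum_toMatrix_smul_self D j]
    simp only [map_sum, map_smul, LinearMap.sum_apply, LinearMap.smul_apply, smul_eq_mul,
      Finset.mul_sum]
    exact Finset.sum_congr rfl fun a _ => Finset.sum_congr rfl fun a' _ => by ring
  have h1 : (Matrix.of fun i j => b (Ξ i) (Ξ j)) = 1 := by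
    ext i j
    simp [hΞ, Matrix.one_apply]
  rw [key b', key b, h1]
  simp only [Matrix.det_mul, Matrix.det_one]
  ring

lemma det_bilin_pos {W : Type*} [AddCommGroup W] [Module ℝ W] {d : ℕ}
    (b : W →ₗ[ℝ] W →ₗ[ℝ] ℝ) (hs : ∀ u v, b u v = b v u) (hp : ∀ u, u ≠ 0 → 0 < b u u)
    (Ξ : Module.Basis (Fin d) ℝ W) : 0 < (Matrix.of fun i j => b (Ξ i) (Ξ j)).det := by
  refine Matrix.PosDef.det_pos (Matrix.PosDef.of_dotProduct_mulVec_pos ?_ ?_)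
  · ext i j
    exact hs _ _
  · intro y hy
    have hne : ∑ i, y i • Ξ i ≠ 0 := by
      intro h
      exact hy (funext (Fintype.linearIndependent_iff.mp Ξ.linearIndependent y h))
    have := hp _ hne
    simp only [map_sum, map_smul, LinearMap.sum_apply, LinearMap.smul_apply, smul_eq_mul] at this
    simp only [dotProduct, Matrix.mulVec, Matrix.of_apply, Finset.mul_sum, Pi.star_apply,
      star_trivial]
    simp only [Finset.mul_sum] at this
    refine this.trans_eq ?_
    refine Finset.sum_congr rfl fun i _ => Finset.sum_congr rfl fun j _ => ?_
    rw [hs (Ξ j)]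
    ring

/-- The constant passes through the integrals, the sum and the infimum; finiteness removes any
measurability condition on the density. -/
lemma riemVolume_eq_mul {d : ℕ} {N : Type*} [TopologicalSpace N]
    [ChartedSpace (EuclideanSpace ℝ (Fin d)) N]
    (g g' : ∀ y : N, TangentSpace 𝓘(ℝ, EuclideanSpace ℝ (Fin d)) y →
      TangentSpace 𝓘(ℝ, EuclideanSpace ℝ (Fin d)) y → ℝ) {C : ℝ} (hC : 0 < C)
    (h : ∀ c u, chartDensity g' c u = C * chartDensity g c u) :
    riemVolume g' = ENNReal.ofReal C * riemVolume g := by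
  rw [riemVolume, riemVolume, ENNReal.mul_iInf_of_ne (by simpa using hC) ENNReal.ofReal_ne_top]
  refine iInf_congr fun p => ?_
  rw [← ENNReal.tsum_mul_left]
  refine tsum_congr fun i => ?_
  rw [← MeasureTheory.lintegral_const_mul' _ _ ENNReal.ofReal_ne_top]
  refine MeasureTheory.lintegral_congr fun u => ?_
  rw [h, ENNReal.ofReal_mul hC.le]

/-- Two left invariant metrics have proportional densities with the same ratio everywhere, read off
on `Ξ`, and the reference volume is one. -/
lemma riemVolume_leftInvMetric {d : ℕ} {G : Type*} [TopologicalSpace G]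
    [ChartedSpace (EuclideanSpace ℝ (Fin d)) G] [Group G] (b : NormalizedInnerProduct d G)
    (b' : LieAlg d G →ₗ[ℝ] LieAlg d G →ₗ[ℝ] ℝ) (Ξ : Module.Basis (Fin d) ℝ (LieAlg d G))
    (hΞ : ∀ i j, b.form (Ξ i) (Ξ j) = if i = j then 1 else 0)
    (hpos : 0 < (Matrix.of fun i j => b' (Ξ i) (Ξ j)).det) :
    riemVolume (leftInvMetric d b') =
      ENNReal.ofReal (√(Matrix.of fun i j => b' (Ξ i) (Ξ j)).det) := by
  rw [riemVolume_eq_mul (leftInvMetric d b.form) (leftInvMetric d b') (Real.sqrt_pos.mpr hpos),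
    b.volume_eq_one, mul_one]
  intro c u
  refine Eq.trans (congrArg Real.sqrt ?_) (Real.sqrt_mul hpos.le _)
  rw [mul_comm]
  exact det_bilin_eq b.form b' Ξ hΞ _

variable {E : Type*} [NormedAddCommGroup E] [NormedSpace ℂ E]
variable {M : Type*} [TopologicalSpace M] [ChartedSpace E M]
variable {d : ℕ} {G : Type*} [TopologicalSpace G] [ChartedSpace (EuclideanSpace ℝ (Fin d)) G]
  [Group G] [MulAction G M]

/-- The Kähler form at a point, as a bilinear form on the model space. -/
def KahlerForm.formAt (K : KahlerForm E M) (x : M) : E →ₗ[ℝ] E →ₗ[ℝ] ℝ := K.form x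

/-- The pullback of the Riemannian metric at a point by the infinitesimal action. -/
def orbitForm (K : KahlerForm E M) (x : M) : LieAlg d G →ₗ[ℝ] LieAlg d G →ₗ[ℝ] ℝ :=
  LinearMap.compl₁₂ (K.formAt x) (infActionₗ (E := E) x) (Complex.I • infActionₗ (E := E) x)

namespace KahlerForm

variable (K : KahlerForm E M)

lemma formAt_alt (x : M) (v : E) : K.formAt x v v = 0 := K.alt x v

lemma formAt_J (x : M) (u v : E) :
    K.formAt x (Complex.I • u) (Complex.I • v) = K.formAt x u v := K.J_invariant x u v

lemma formAt_pos (x : M) (v : E) (hv : v ≠ 0) : 0 < K.formAt x v (Complex.I • v) :=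
  K.pos x v hv

lemma formAt_skew (x : M) (u v : E) : K.formAt x u v = - K.formAt x v u := by
  have h := K.formAt_alt x (u + v)
  simp only [map_add, LinearMap.add_apply, formAt_alt] at h
  linarith

lemma formAt_metric_symm (x : M) (u v : E) :
    K.formAt x u (Complex.I • v) = K.formAt x v (Complex.I • u) := by
  rw [← K.formAt_J, smul_smul, Complex.I_mul_I, neg_one_smul, map_neg, K.formAt_skew, neg_neg]

end KahlerForm

namespace HamiltonianAction

variable {K : KahlerForm E M}

/-- If the field of `ξ` vanishes at `x`, so does `dφ_ξ`; but by regularity `l ξ` is a value of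
`dφ_ξ` for every functional `l`. -/
lemma infAction_injective (H : HamiltonianAction d G K) {x : M} (hx : H.Φ x = 0) :
    Function.Injective (infActionₗ (E := E) (d := d) (G := G) x) := by
  rw [injective_iff_map_eq_zero]
  intro ξ hξ
  have h0 : ∀ v : E, mvfderiv 𝓘(ℝ, E) (fun y => H.Φ y ξ) x v = 0 := by
    intro v
    rw [← H.hamiltonian ξ x v]
    change K.formAt x (infActionₗ (E := E) x ξ) v = 0
    rw [hξ, map_zero, LinearMap.zero_apply]
  by_contra hne
  obtain ⟨l, hl⟩ : ∃ l : Module.Dual ℝ (LieAlg d G), l ξ ≠ 0 := by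
    by_contra hcon
    push Not at hcon
    exact hne ((Module.forall_dual_apply_eq_zero_iff ℝ ξ).mp hcon)
  obtain ⟨v, hv⟩ := H.regular x hx l
  exact hl ((hv ξ).symm.trans (h0 v))

lemma orbitForm_det_pos (H : HamiltonianAction d G K) {x : M} (hx : H.Φ x = 0) (Ξ : Module.Basis (Fin d) ℝ (LieAlg d G)) :
    0 < (Matrix.of fun i j => orbitForm K x (Ξ i) (Ξ j)).det := by
  refine det_bilin_pos _ ?_ ?_ Ξ
  · intro ξ η
    exact K.formAt_metric_symm x _ _
  · intro ξ hξ
    refine K.formAt_pos x _ fun h => hξ ?_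
    exact H.infAction_injective hx (h.trans (map_zero _).symm)

lemma metric_push (H : HamiltonianAction d G K) (g : G) (x : M) (u v : E) :
    K.metric (g • x) (pushReal g x u) (pushReal g x v) = K.metric x u v := by
  have h : (show E from Complex.I • (show E from pushReal g x v)) = pushReal g x (Complex.I • v : E) := by
    rw [pushReal_eq_pushComplex (H.holomorphic g x), pushReal_eq_pushComplex (H.holomorphic g x)]
    exact ((pushComplex g x).map_smul Complex.I v).symm
  refine Eq.trans ?_ (H.symplectic g x u (Complex.I • v : E))
  exact congrArg (fun w : E => K.formAt (g • x) (pushReal g x u) w) h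

variable [LieGroup 𝓘(ℝ, EuclideanSpace ℝ (Fin d)) ∞ G]
  [ContMDiffSMul 𝓘(ℝ, EuclideanSpace ℝ (Fin d)) 𝓘(ℝ, E) ∞ G M]

/-- Because `h x = g (g⁻¹ h) x` and `g` is an isometry of `M`, the pulled-back metric on `G` is left
invariant, with `orbitForm` as its value at the identity. -/
lemma orbitVolume_eq (H : HamiltonianAction d G K) (b : NormalizedInnerProduct d G)
    (Ξ : Module.Basis (Fin d) ℝ (LieAlg d G))
    (hΞ : ∀ i j, b.form (Ξ i) (Ξ j) = if i = j then 1 else 0) {x : M} (hx : H.Φ x = 0) :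
    orbitVolume d G K x = √(Matrix.of fun i j => orbitForm K x (Ξ i) (Ξ j)).det := by
  have hg : (fun (g : G) (v w : TangentSpace 𝓘(ℝ, EuclideanSpace ℝ (Fin d)) g) =>
      K.metric (g • x)
        (mfderiv 𝓘(ℝ, EuclideanSpace ℝ (Fin d)) 𝓘(ℝ, E) (fun h : G => h • x) g v)
        (mfderiv 𝓘(ℝ, EuclideanSpace ℝ (Fin d)) 𝓘(ℝ, E) (fun h : G => h • x) g w)) =
      leftInvMetric d (orbitForm K x) := by
    funext g v w
    refine Eq.trans ?_ (H.metric_push g x _ _)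
    exact congrArg₂ (fun a c : E => K.metric (g • x) a c) (mfderiv_smul_const g x v)
      (mfderiv_smul_const g x w)
  rw [orbitVolume, hg, riemVolume_leftInvMetric b _ Ξ hΞ (H.orbitForm_det_pos hx Ξ),
    ENNReal.toReal_ofReal (Real.sqrt_nonneg _)]

lemma orbitForm_smul (H : HamiltonianAction d G K) (g : G) (x : M) (ξ η : LieAlg d G) :
    orbitForm K (g • x) ξ η = orbitForm K x (Ad d g⁻¹ ξ) (Ad d g⁻¹ η) := by
  refine Eq.trans ?_ (H.metric_push g x _ _)
  exact congrArg₂ (fun a c : E => K.metric (g • x) a c) (infAction_smul g x ξ)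
    (infAction_smul g x η)

/-- Moving the point by `g` inserts `Ad g⁻¹` in both arguments, and this sends `Ξ` to another
orthonormal family. -/
lemma orbitForm_det_smul (H : HamiltonianAction d G K) (b : NormalizedInnerProduct d G)
    (Ξ : Module.Basis (Fin d) ℝ (LieAlg d G))
    (hΞ : ∀ i j, b.form (Ξ i) (Ξ j) = if i = j then 1 else 0) (g : G) (x : M) :
    (Matrix.of fun i j => orbitForm K (g • x) (Ξ i) (Ξ j)).det =
      (Matrix.of fun i j => orbitForm K x (Ξ i) (Ξ j)).det := by
  have h1 : (Matrix.of fun i j => b.form (Ad d g⁻¹ (Ξ i)) (Ad d g⁻¹ (Ξ j))) = 1 := by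
    ext i j
    rw [Matrix.of_apply, b.ad_invariant, hΞ, Matrix.one_apply]
  simp only [H.orbitForm_smul]
  rw [det_bilin_eq b.form (orbitForm K x) Ξ hΞ fun i => Ad d g⁻¹ (Ξ i), h1, Matrix.det_one,
    one_mul]

end HamiltonianAction

end OrbitVolume

/-! ### Descent to the quotient and independence of the representative -/

section Reduction

lemma halfFormMag_congr {V V' : Type*} (n : ℕ) (w : V → V → ℝ) (w' : V' → V' → ℝ)
    (α : (Fin n → V) → ℂ) (α' : (Fin n → V') → ℂ) (T : V → V') (hT : Function.Surjective T)
    (hw : ∀ u v, w' (T u) (T v) = w u v) (hα : ∀ v, α' (fun i => T (v i)) = α v) :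
    halfFormMag n w' α' = halfFormMag n w α := by
  have h1 : ∀ v : Fin n ⊕ Fin n → V, wedgeConj n α' (T ∘ v) = wedgeConj n α v := by
    intro v
    simp only [wedgeConj, Function.comp_apply]
    congr 1
    refine Finset.sum_congr rfl fun σ _ => ?_
    rw [hα fun i => v (σ (Sum.inl i)), hα fun i => v (σ (Sum.inr i))]
  have h2 : ∀ v : Fin n ⊕ Fin n → V, liouville n w' (T ∘ v) = liouville n w v := by
    intro v
    simp only [liouville, Function.comp_apply, hw]
  rw [halfFormMag, halfFormMag]
  congr 1
  ext t
  simp only [Set.mem_ofPred_eq]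
  refine and_congr_right fun _ => ⟨fun h v => ?_, fun h v => ?_⟩
  · rw [← h1, ← h2, h]
  · obtain ⟨u, rfl⟩ := hT.comp_left v
    rw [h1, h2, h]

/-- Transport of the magnitude on a tensor product along linear isomorphisms which preserve the
first factor's magnitude and scale that of the second. -/
lemma tensorMag_congr {V W V' W' : Type*} [AddCommGroup V] [Module ℂ V] [AddCommGroup W]
    [Module ℂ W] [AddCommGroup V'] [Module ℂ V'] [AddCommGroup W'] [Module ℂ W']
    (eV : V ≃ₗ[ℂ] V') (eW : W ≃ₗ[ℂ] W') (a : V → ℝ) (b : W → ℝ) (a' : V' → ℝ) (b' : W' → ℝ)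
    (k : ℕ) {C : ℝ} (hC : 0 ≤ C) (ha : ∀ v, a v = a' (eV v)) (hb : ∀ w, b w = C * b' (eW w))
    (t : (⨂[ℂ]^k V) ⊗[ℂ] W) :
    tensorMag a b k t = C * tensorMag a' b' k
      (TensorProduct.congr (PiTensorProduct.congr fun _ : Fin k => eV) eW t) := by
  -- The factor `C` occurs once, not to the power `k`, because only the second tensor factor is
  -- rescaled.
  rw [tensorMag, tensorMag, ← smul_eq_mul, ← Real.sInf_smul_of_nonneg hC]
  congr 1
  ext c
  simp only [Set.mem_ofPred_eq, Set.mem_smul_set, smul_eq_mul]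
  constructor
  · rintro ⟨v, w, rfl, rfl⟩
    refine ⟨a' (eV v) ^ k * b' (eW w), ⟨eV v, eW w, ?_, rfl⟩, ?_⟩
    · simp
    · rw [ha, hb]
      ring
  · rintro ⟨_, ⟨v', w', ht, rfl⟩, rfl⟩
    refine ⟨eV.symm v', eW.symm w', ?_, ?_⟩
    · rw [← LinearEquiv.eq_symm_apply] at ht
      rw [ht]
      simp
    · rw [ha, hb, eV.apply_symm_apply, eW.apply_symm_apply]
      ring

lemma tensorMap_comp {k : ℕ} {V V₁ V₂ W W₁ W₂ : Type*} [AddCommGroup V] [Module ℂ V]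
    [AddCommGroup V₁] [Module ℂ V₁] [AddCommGroup V₂] [Module ℂ V₂] [AddCommGroup W] [Module ℂ W]
    [AddCommGroup W₁] [Module ℂ W₁] [AddCommGroup W₂] [Module ℂ W₂] {f : V →ₗ[ℂ] V₁}
    {g : V₁ →ₗ[ℂ] V₂} {h : V →ₗ[ℂ] V₂} {f' : W →ₗ[ℂ] W₁} {g' : W₁ →ₗ[ℂ] W₂} {h' : W →ₗ[ℂ] W₂}
    (hc : h = g.comp f) (hc' : h' = g'.comp f') (t : (⨂[ℂ]^k V) ⊗[ℂ] W) :
    TensorProduct.map (PiTensorProduct.map fun _ : Fin k => h) h' t =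
      TensorProduct.map (PiTensorProduct.map fun _ : Fin k => g) g'
        (TensorProduct.map (PiTensorProduct.map fun _ : Fin k => f) f' t) := by
  rw [hc, hc', PiTensorProduct.map_comp, TensorProduct.map_comp]
  rfl

variable {E : Type*} [NormedAddCommGroup E] [NormedSpace ℂ E]
variable {M : Type*} [TopologicalSpace M] [ChartedSpace E M]
variable {d : ℕ} {G : Type*} [TopologicalSpace G] [ChartedSpace (EuclideanSpace ℝ (Fin d)) G]
  [Group G] [MulAction G M]

namespace HamiltonianAction

variable {K : KahlerForm E M}

lemma exists_move_eq (H : HamiltonianAction d G K) {q : H.Reduced} (x y : H.Orbit q) : ∃ g : G, x.move g = y := by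
  obtain ⟨g, hg⟩ := H.exists_smul_eq (x.2.trans y.2.symm)
  exact ⟨g, Subtype.ext hg⟩

lemma move_injective (H : HamiltonianAction d G K) {q : H.Reduced} (x : H.Orbit q) {g h : G} (hgh : x.move g = x.move h) :
    g = h := by
  have h1 : g • x.pt = h • x.pt := congrArg HamiltonianAction.Orbit.pt hgh
  have h2 : (h⁻¹ * g) • x.pt = x.pt := by
    rw [mul_smul, h1, inv_smul_smul]
  exact (inv_mul_eq_one.mp (H.free x.pt x.1.2 _ h2)).symm

lemma pushComplex_surjective (H : HamiltonianAction d G K) (g : G) (x : M) :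
    Function.Surjective (fun v : E => (show E from pushComplex g x v)) := by
  intro v
  refine ⟨(show E from pushComplex g⁻¹ (g • x) v), ?_⟩
  have h1 := pushComplex_mul (x := g • x) (H.holomorphic g) (H.holomorphic g⁻¹) v
  -- The points `g⁻¹ • g • x` and `x` are only propositionally equal, so the base point is
  -- generalized to a variable.
  have h2 : ∀ y : M, y = x → (show E from pushComplex g y (pushComplex g⁻¹ (g • x) v : E)) =
      (show E from pushComplex g x (pushComplex g⁻¹ (g • x) v : E)) := by
    rintro y rfl
    rfl
  refine (h2 _ (inv_smul_smul g x)).symm.trans (h1.symm.trans ?_)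
  rw [mul_inv_cancel]
  exact pushComplex_one (g • x) v

lemma formAt_push (H : HamiltonianAction d G K) (g : G) (x : M) (u v : E) :
    K.formAt (g • x) (pushComplex g x u) (pushComplex g x v) = K.formAt x u v := by
  refine Eq.trans ?_ (H.symplectic g x u v)
  exact (congrArg₂ (fun a c : E => K.formAt (g • x) a c)
    (pushReal_eq_pushComplex (H.holomorphic g x) u)
    (pushReal_eq_pushComplex (H.holomorphic g x) v)).symm

/-- The moment map equation identifies the kernel of `dΦ` with the `ω`-orthogonal of the orbit
directions. -/
lemma mem_horizontal_iff (H : HamiltonianAction d G K) {x : M} {v : E} : v ∈ H.horizontal x ↔ ∀ ξ : LieAlg d G,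
    K.formAt x (infActionₗ x ξ) v = 0 ∧ K.formAt x (infActionₗ x ξ) (Complex.I • v) = 0 := by
  refine forall_congr' fun ξ => and_congr ?_ ?_
  · exact Eq.congr_left (H.hamiltonian ξ x v).symm
  · exact Eq.congr_left (H.hamiltonian ξ x (Complex.I • v : E)).symm

lemma lift_injective (H : HamiltonianAction d G K) {q : H.Reduced} (x : H.Orbit q) : Function.Injective (H.lift x) := by
  rw [injective_iff_map_eq_zero]
  intro Y hY
  have hY' : Y.1.1 x = 0 := hY
  apply Subtype.ext
  apply Subtype.ext
  funext y
  obtain ⟨g, rfl⟩ := H.exists_move_eq x y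
  rw [← Y.1.2 g x, hY', map_zero]
  rfl

section Smooth

variable [ContMDiffSMul 𝓘(ℝ, EuclideanSpace ℝ (Fin d)) 𝓘(ℝ, E) ∞ G M]

/-- The orbits in the zero set of the moment map are isotropic. -/
lemma formAt_infAction (H : HamiltonianAction d G K) {x : M} (hx : H.Φ x = 0) (ξ η : LieAlg d G) :
    K.formAt x (infActionₗ x ξ) (infActionₗ x η) = 0 := by
  refine (H.hamiltonian ξ x (infAction η x)).trans ?_
  -- By equivariance `φ_ξ` vanishes along the orbit, so its derivative in the direction of `η` is
  -- zero.
  have hc : (fun y => H.Φ y ξ) ∘ (fun g : G => g • x) = fun _ => (0 : ℝ) := by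
    funext g
    simp only [Function.comp_apply]
    rw [H.equivariant, hx, LinearMap.zero_apply]
  have h1 := mfderiv_comp_apply_of_eq (x := (1 : G)) (y := x)
    ((H.smooth ξ).mdifferentiable (by simp) x) (mdifferentiable_smul_const E d x (1 : G))
    (one_smul G x) η
  have h2 : (mfderiv 𝓘(ℝ, EuclideanSpace ℝ (Fin d)) 𝓘(ℝ, ℝ)
      ((fun y => H.Φ y ξ) ∘ (fun g : G => g • x)) 1 : EuclideanSpace ℝ (Fin d) →L[ℝ] ℝ) = 0 := by
    rw [hc]
    exact mfderiv_const
  exact h1.symm.trans (congrArg (fun T : EuclideanSpace ℝ (Fin d) →L[ℝ] ℝ => T η) h2)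

lemma halfFormMag_contract_infAction (H : HamiltonianAction d G K) [FiniteDimensional ℂ E] {m : ℕ}
    (hE : Module.finrank ℂ E = d + m) (Ξ : Module.Basis (Fin d) ℝ (LieAlg d G)) {x : M}
    (hx : H.Φ x = 0) {W : Type*} [AddCommGroup W] [Module ℂ W] (l : W →ₗ[ℂ] E)
    (hl : Function.Injective l) (hr : ∀ v, v ∈ LinearMap.range l ↔ v ∈ H.horizontal x)
    (α : E [⋀^Fin (d + m)]→ₗ[ℂ] ℂ) :
    halfFormMag m (fun Y Z => K.formAt x (l Y) (l Z))
        ((contract (fun i => infActionₗ (E := E) x (Ξ i)) α).compLinearMap l) =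
      (2 : ℝ) ^ (-(d : ℝ) / 2) *
        √(Matrix.of fun i j => orbitForm K x (Ξ i) (Ξ j)).det *
        halfFormMag (d + m) (fun u w => K.formAt x u w) α := by
  have hX : LinearIndependent ℝ (fun i => infActionₗ (E := E) x (Ξ i)) :=
    Ξ.linearIndependent.map' _ (LinearMap.ker_eq_bot.mpr (H.infAction_injective hx))
  refine halfFormMag_contract hE (K.formAt x) (K.formAt_alt x) (K.formAt_J x)
    (K.formAt_pos x) (fun i => infActionₗ (E := E) x (Ξ i)) hX
    (fun i j => H.formAt_infAction hx _ _) l hl ?_ α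
  intro v
  rw [hr, mem_horizontal_iff]
  refine ⟨fun h i => h (Ξ i), fun h ξ => ?_⟩
  have key : ∀ u : E, (∀ i, K.formAt x (infActionₗ x (Ξ i)) u = 0) →
      K.formAt x (infActionₗ x ξ) u = 0 := by
    intro u hu
    rw [← Ξ.sum_repr ξ]
    simp only [map_sum, map_smul, LinearMap.sum_apply, LinearMap.smul_apply, hu, smul_zero,
      Finset.sum_const_zero]
  exact ⟨key v fun i => (h i).1, key _ fun i => (h i).2⟩

variable [LieGroup 𝓘(ℝ, EuclideanSpace ℝ (Fin d)) ∞ G]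

lemma infActionₗ_smul (H : HamiltonianAction d G K) (g : G) (x : M) (ξ : LieAlg d G) :
    (infActionₗ (g • x) ξ : E) = (show E from pushComplex g x (infActionₗ x (Ad d g⁻¹ ξ) : E)) :=
  (infAction_smul g x ξ).trans (pushReal_eq_pushComplex (H.holomorphic g x) _)

lemma push_mem_horizontal (H : HamiltonianAction d G K) (g : G) (x : M) {v : E} (hv : v ∈ H.horizontal x) :
    (show E from pushComplex g x v) ∈ H.horizontal (g • x) := by
  rw [mem_horizontal_iff] at hv ⊢
  intro ξ
  rw [H.infActionₗ_smul g x ξ]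
  have hI : (Complex.I • (show E from pushComplex g x v) : E) =
    (show E from pushComplex g x (Complex.I • v : E)) :=
      ((pushComplex g x).map_smul Complex.I v).symm
  rw [hI]
  exact ⟨(H.formAt_push g x _ v).trans (hv _).1,
    (H.formAt_push g x _ (Complex.I • v)).trans (hv _).2⟩

/-- Every vector of the maximal complex subspace extends to a tangent vector of the quotient. -/
lemma mem_range_lift_iff (H : HamiltonianAction d G K) {q : H.Reduced} (x : H.Orbit q) (w : E) :
    w ∈ LinearMap.range (H.lift x) ↔ w ∈ H.horizontal x.pt := by
  constructor
  · rintro ⟨Y, rfl⟩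
    exact Y.2 x
  · intro hw
    -- Freeness makes the group element carrying `x` to `y` unique, so transporting `w` by `γ y`
    -- gives an equivariant family: `γ (g y) = g γ y`.
    choose γ hγ using H.exists_move_eq x
    let f : ∀ y : H.Orbit q, TangentSpace 𝓘(ℂ, E) y.pt := fun y =>
      (show E from pushComplex (γ y) x.pt w)
    have hpt : ∀ y, γ y • x.pt = y.pt := fun y => congrArg HamiltonianAction.Orbit.pt (hγ y)
    have hf : f ∈ H.descend (L := fun x : M => TangentSpace 𝓘(ℂ, E) x) pushComplex q := by
      intro g y
      have hg : γ (y.move g) = g * γ y := by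
        apply H.move_injective x
        rw [hγ]
        apply Subtype.ext
        have := congrArg Subtype.val (hγ y)
        change g • y.1 = (g * γ y) • x.1
        rw [mul_smul]
        exact (congrArg (g • ·) this).symm
      have h1 : ∀ p : M, p = y.pt → (show E from pushComplex g p (f y : E)) =
          (show E from pushComplex g y.pt (f y : E)) := by
        rintro p rfl
        rfl
      refine (h1 _ (hpt y)).symm.trans ?_
      refine (pushComplex_mul (H.holomorphic g) (H.holomorphic (γ y)) w).symm.trans ?_
      change (show E from pushComplex (g * γ y) x.pt w) =
        (show E from pushComplex (γ (y.move g)) x.pt w)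
      rw [hg]
    have hh : (⟨f, hf⟩ : H.descend (L := fun x : M => TangentSpace 𝓘(ℂ, E) x) pushComplex q) ∈
        H.tangent q := by
      intro y
      have h2 := H.push_mem_horizontal (γ y) x.pt hw
      have h3 : ∀ p : M, p = y.pt → (f y : E) ∈ H.horizontal p → (f y : E) ∈ H.horizontal y.pt := by
        rintro p rfl h
        exact h
      exact h3 _ (hpt y) h2
    refine ⟨⟨⟨f, hf⟩, hh⟩, ?_⟩
    have h1 : γ x = 1 := by
      apply H.move_injective x
      rw [hγ]
      apply Subtype.ext
      exact (one_smul G x.1).symm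
    change (show E from pushComplex (γ x) x.pt w) = w
    rw [h1]
    exact pushComplex_one x.pt w

/-- The half-form magnitude on the quotient in terms of that on `M`. -/
lemma halfFormMag_descendForm (H : HamiltonianAction d G K) [FiniteDimensional ℂ E] {m : ℕ}
    (hE : Module.finrank ℂ E = d + m) (Ξ : Module.Basis (Fin d) ℝ (LieAlg d G)) {q : H.Reduced}
    (x : H.Orbit q) (α : TangentSpace 𝓘(ℂ, E) x.pt [⋀^Fin (d + m)]→ₗ[ℂ] ℂ) :
    halfFormMag m (fun Y Z => K.form x.pt (H.lift x Y) (H.lift x Z))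
        (fun Y => H.descendForm Ξ x α Y) =
      (2 : ℝ) ^ (-(d : ℝ) / 2) *
        √(Matrix.of fun i j => orbitForm K x.pt (Ξ i) (Ξ j)).det *
        halfFormMag (d + m) (fun u w : TangentSpace 𝓘(ℝ, E) x.pt => K.form x.pt u w)
          (fun u => α u) := by
  have hr := fun w => H.mem_range_lift_iff x w
  have hl := H.halfFormMag_contract_infAction hE Ξ x.1.2 (W := H.tangent q) (H.lift x)
    (H.lift_injective x)
  have hl' := hl hr
  have h := hl' α
  refine Eq.trans ?_ (h.trans ?_)
  · rfl
  · rfl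

end Smooth

end HamiltonianAction

/-! ### The reduced bundles and the final comparison -/

section Bundles

variable {K : KahlerForm E M} {H : HamiltonianAction d G K} {m : ℕ}
  {L : M → Type*} [∀ x, AddCommGroup (L x)] [∀ x, Module ℂ (L x)]
  [∀ x, TopologicalSpace (L x)] [∀ x, IsTopologicalAddGroup (L x)] [∀ x, ContinuousSMul ℝ (L x)]
  [TopologicalSpace (TotalSpace ℂ L)] [FiberBundle ℂ L]
  {S : M → Type*} [∀ x, AddCommGroup (S x)] [∀ x, Module ℂ (S x)]
  [∀ x, TopologicalSpace (S x)] [TopologicalSpace (TotalSpace ℂ S)] [FiberBundle ℂ S]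

lemma redHermitian_eq [IsManifold 𝓘(ℂ, E) ω M] (P : Prequantum H L) {q : H.Reduced} (y : H.Orbit q)
    (v : RedPrequantum P q) : redHermitian P q v v = P.h y.pt (v.1 y) (v.1 y) := by
  obtain ⟨g, rfl⟩ := H.exists_move_eq (HamiltonianAction.Orbit.rep q) y
  rw [← v.2 g]
  exact (P.unitary g _ _ _).symm

lemma halfFormMag_move (Q : HalfForm (E := E) (d + m) d G S) {q : H.Reduced} (x : H.Orbit q)
    (g : G) (ν : RedHalfForm Q H q) :
    halfFormMag (d + m) (fun u w : TangentSpace 𝓘(ℝ, E) (x.move g).pt => K.form _ u w)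
        (fun u => Q.mul _ (ν.1 (x.move g)) (ν.1 (x.move g)) u) =
      halfFormMag (d + m) (fun u w : TangentSpace 𝓘(ℝ, E) x.pt => K.form x.pt u w)
        (fun u => Q.mul _ (ν.1 x) (ν.1 x) u) := by
  rw [← ν.2 g]
  exact halfFormMag_congr (d + m) _ _ _ _ (fun v : E => (show E from pushComplex g x.pt v))
    (H.pushComplex_surjective g x.pt) (H.formAt_push g x.pt) (Q.compatible g x.pt _ _)

variable [IsManifold 𝓘(ℂ, E) ω M]

/-- At the chosen representative this is the definition of `Bk`. Elsewhere on the orbit, evaluation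
of descended vectors and the invariant section `r` are transported by the same bundle maps. -/
lemma congr_evalEquiv_Bk (P : Prequantum H L) (Q : HalfForm (E := E) (d + m) d G S) (k : ℕ)
    (r : invariantSections P Q k) {q : H.Reduced} (y : H.Orbit q) :
    TensorProduct.congr (PiTensorProduct.congr fun _ : Fin k => H.evalEquiv P.action y)
      (H.evalEquiv Q.action y) (Bk P Q k r q) = r.1 y.pt := by
  obtain ⟨g, rfl⟩ := H.exists_move_eq (HamiltonianAction.Orbit.rep q) y
  set x := HamiltonianAction.Orbit.rep q
  refine Eq.trans ?_ (r.2 g x.pt)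
  let e := TensorProduct.congr (PiTensorProduct.congr fun _ : Fin k => H.evalEquiv P.action x)
    (H.evalEquiv Q.action x)
  have hB : r.1 x.pt = e (Bk P Q k r q) := (e.apply_symm_apply _).symm
  rw [hB]
  generalize Bk P Q k r q = t
  have hP : (H.evalEquiv P.action (x.move g)).toLinearMap =
      (P.action.map g x.pt).comp (H.evalEquiv P.action x).toLinearMap :=
    LinearMap.ext fun v => (v.2 g x).symm
  have hQ : (H.evalEquiv Q.action (x.move g)).toLinearMap =
      (Q.action.map g x.pt).comp (H.evalEquiv Q.action x).toLinearMap :=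
    LinearMap.ext fun v => (v.2 g x).symm
  exact tensorMap_comp hP hQ t

variable [LieGroup 𝓘(ℝ, EuclideanSpace ℝ (Fin d)) ∞ G]
  [ContMDiffSMul 𝓘(ℝ, EuclideanSpace ℝ (Fin d)) 𝓘(ℝ, E) ∞ G M]

/-- The magnitude of the reduced section at an orbit, evaluated at any point of the orbit. -/
theorem redMag_Bk [FiniteDimensional ℂ E] (hE : Module.finrank ℂ E = d + m) (P : Prequantum H L)
    (Q : HalfForm (E := E) (d + m) d G S) (b : NormalizedInnerProduct d G)
    (Ξ : Module.Basis (Fin d) ℝ (LieAlg d G))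
    (hΞ : ∀ i j, b.form (Ξ i) (Ξ j) = if i = j then 1 else 0)
    (k : ℕ) (r : invariantSections P Q k) {q : H.Reduced} (y : H.Orbit q) :
    redMag P Q k Ξ q (Bk P Q k r q) =
      (2 : ℝ) ^ (-(d : ℝ) / 2) * orbitVolume d G K y.pt * mag P Q k y.pt (r.1 y.pt) := by
  have hC : 0 ≤ (2 : ℝ) ^ (-(d : ℝ) / 2) * orbitVolume d G K y.pt :=
    mul_nonneg (by positivity) ENNReal.toReal_nonneg
  rw [redMag, tensorMag_congr (H.evalEquiv P.action y) (H.evalEquiv Q.action y) _ _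
    (fun v => (P.h y.pt v v).re)
    (fun ν => halfFormMag (d + m) (fun u w : TangentSpace 𝓘(ℝ, E) y.pt => K.form y.pt u w)
      (fun u => Q.mul y.pt ν ν u)) k hC
    (fun v => congrArg Complex.re (redHermitian_eq P y v)) ?_, congr_evalEquiv_Bk, mag]
  intro ν
  -- The reduced magnitude is computed at the representative; the Gram determinant and the half-form
  -- magnitude are then each carried along the orbit to `y`.
  obtain ⟨g, rfl⟩ := H.exists_move_eq (HamiltonianAction.Orbit.rep q) y
  refine (H.halfFormMag_descendForm hE Ξ (HamiltonianAction.Orbit.rep q) _).trans ?_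
  refine congrArg₂ (fun c c' : ℝ => (2 : ℝ) ^ (-(d : ℝ) / 2) * c * c') ?_
    (halfFormMag_move Q _ g ν).symm
  refine (congrArg Real.sqrt (H.orbitForm_det_smul b Ξ hΞ g _).symm).trans ?_
  exact (H.orbitVolume_eq b Ξ hΞ (HamiltonianAction.Orbit.move g _).1.2).symm

end Bundles

end Reduction

end

end GeomQuant

open GeomQuant in
theorem mainTheorem8
    {d m : ℕ}
    {E : Type*} [NormedAddCommGroup E] [NormedSpace ℂ E] [FiniteDimensional ℂ E]
    (hE : Module.finrank ℂ E = d + m)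
    {M : Type*} [TopologicalSpace M] [T2Space M] [CompactSpace M] [ConnectedSpace M]
    [ChartedSpace E M] [IsManifold 𝓘(ℂ, E) ω M]
    {G : Type*} [TopologicalSpace G] [T2Space G] [CompactSpace G] [ConnectedSpace G] [Group G]
    [ChartedSpace (EuclideanSpace ℝ (Fin d)) G] [LieGroup 𝓘(ℝ, EuclideanSpace ℝ (Fin d)) ∞ G]
    [MulAction G M] [ContMDiffSMul 𝓘(ℝ, EuclideanSpace ℝ (Fin d)) 𝓘(ℝ, E) ∞ G M]
    (K : KahlerForm E M) (H : HamiltonianAction d G K)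
    {L : M → Type*} [∀ x, AddCommGroup (L x)] [∀ x, Module ℂ (L x)]
    [∀ x, TopologicalSpace (L x)] [∀ x, IsTopologicalAddGroup (L x)]
    [∀ x, ContinuousSMul ℝ (L x)] [TopologicalSpace (TotalSpace ℂ L)] [FiberBundle ℂ L]
    [VectorBundle ℂ ℂ L] [VectorBundle ℝ ℂ L] [ContMDiffVectorBundle ∞ ℂ L 𝓘(ℝ, E)]
    {S : M → Type*} [∀ x, AddCommGroup (S x)] [∀ x, Module ℂ (S x)]
    [∀ x, TopologicalSpace (S x)] [TopologicalSpace (TotalSpace ℂ S)] [FiberBundle ℂ S]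
    [VectorBundle ℂ ℂ S] [VectorBundle ℝ ℂ S] [ContMDiffVectorBundle ∞ ℂ S 𝓘(ℝ, E)]
    (P : Prequantum H L) (Q : HalfForm (E := E) (d + m) d G S)
    (b : NormalizedInnerProduct d G) (Ξ : Module.Basis (Fin d) ℝ (LieAlg d G))
    (hΞ : ∀ i j, b.form (Ξ i) (Ξ j) = if i = j then 1 else 0)
    (k : ℕ) (r : invariantSections P Q k) (hr : IsHolomorphic P Q k r.1)
    (x₀ : H.zeroSet) :
    redMag P Q k Ξ (H.proj x₀) (Bk P Q k r (H.proj x₀)) =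
      (2 : ℝ) ^ (-(d : ℝ) / 2) * orbitVolume d G K (x₀ : M) * mag P Q k (x₀ : M) (r.1 x₀) :=
  redMag_Bk hE P Q b Ξ hΞ k r (q := H.proj x₀) ⟨x₀, rfl⟩
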